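/- Let $d\ge 0$ be an integer, $\alpha\in(1,2)$, $p\in(0,\min(\tfrac12,\alpha-1))$, $\eta,\sigma>0$, $K_1,K_2,B,m,K>0$ and $D\in\mathbb{R}$. Then there is a finite constant $\hat C_\gamma>0$, depending only on $d,\alpha,p,\eta,\sigma,K_1,K_2,B,m,K,D$, such that the following holds. Let $\mathcal X$ be a subset of a normed space with $\|x-\hat x\|\le D$ for all $x,\hat x\in\mathcal X$, and let $f$ be a real-valued loss, with $f(\cdot,x):\mathbb{R}^d\to\mathbb{R}$ differentiable for every $x\in\mathcal X$, such that for all $\theta,\hat\theta\in\mathbb{R}^d$ and $x,\hat x\in\mathcal X$ $$\|\nabla f(\theta,x)-\nabla f(\hat\theta,\hat x)\|\le K_1\|\theta-\hat\theta\|+K_2\|x-\hat x\|\,(\|\theta\|+\|\hat\theta\|+1),$$ $$\|\nabla f(0,x)\|\le B,\qquad \langle\nabla f(\theta,x)-\nabla f(\hat\theta,x),\theta-\hat\theta\rangle\ge m\|\theta-\hat\theta\|^2-K ,$$ where gradients are taken in the first variable. Let $n\ge1$, let $X_n=(x_1,\dots,x_n)$ and $\hat X_n=(\hat x_1,\dots,\hat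 x_n)$ in $\mathcal X^n$ differ in at most one entry, and put $F(\theta,X_n)=\frac1n\sum_{i=1}^n f(\theta,x_i)$, and likewise $F(\theta,\hat X_n)$. Let $\xi$ be a random vector in $\mathbb{R}^d$ with the rotationally invariant $\alpha$-stable law, $\mathbb{E}[e^{\mathrm{i}u^\top\xi}]=e^{-\|u\|^\alpha}$ for $u\in\mathbb{R}^d$. Let $P$ and $\hat P$ be the one-step transition kernels of noisy gradient descent on the two data sets: $P(\theta,\cdot)$ is the law of $\theta-\eta\nabla F(\theta,X_n)+\sigma\xi$, and $\hat P(\theta,\cdot)$ is the law of $\theta-\eta\nabla F(\theta,\hat X_n)+\sigma\xi$. Let $\theta_\star,\hat\theta_\star\in\mathbb{R}^d$ be any stable points of the two objectives, i.e. $\nabla F(\theta_\star,X_n)=0$ and $\nabla F(\hat\theta_\star,\hat X_n)=0$, and set $$V_p(\theta)=(1+\|\theta-\theta_\star\|^2)^{p/2},\qquad \hat V_p(\theta)=(1+\|\theta-\hat\theta_\star\|^2)^{(1+p)/2}.$$ Then, for every $\theta\in\mathbb{R}^d$, $V_p$ is integrable with respect to $P(\theta,\cdot)$ and $\hat P(\theta,\cdot)$,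 and $$\sup_{\theta\in\mathbb{R}^d}\frac{\|P(\theta,\cdot)-\hat P(\theta,\cdot)\|_{V_p}}{\hat V_p(\theta)}\le\frac{\hat C_\gamma}{n},$$ where $\|\mu-\nu\|_V=\sup_{|g|\le V}\left|\int g\,d\mu-\int g\,d\nu\right|$, the supremum being over measurable $g:\mathbb{R}^d\to\mathbb{R}$ with $|g|\le V$. The existence of a point at which $\nabla f(\cdot,x)$ vanishes for all $x\in\mathcal X$ simultaneously is not assumed. -/

import Mathlib

open MeasureTheory ProbabilityTheory
open scoped ENNReal

namespace NoisyGD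

/-- The parameter space `ℝ^d` with its Euclidean norm. -/
abbrev Param (d : ℕ) : Type := EuclideanSpace ℝ (Fin d)

/-- The rotationally invariant `α`-stable distribution on `ℝ^d`: the probability measure whose
characteristic function is `u ↦ exp (-‖u‖ ^ α)` (the value `1` at `u = 0` forces total mass `1`). -/
def IsRotInvStable {d : ℕ} (α : ℝ) (ν : Measure (Param d)) : Prop :=
  ∀ u : Param d, charFun ν u = ((Real.exp (-(‖u‖ ^ α)) : ℝ) : ℂ)

/-- Empirical risk `F(θ, X) = (1/n) ∑ i, f(θ, x_i)`. -/
noncomputable def empRisk {d n : ℕ} {E : Type*} (f : Param d → E → ℝ) (X : Fin n → E)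
    (θ : Param d) : ℝ :=
  (n : ℝ)⁻¹ * ∑ i, f θ (X i)

/-- Pseudo-Lipschitz continuity of the gradient of the loss, for data in `𝒳`. -/
structure PseudoLipschitzGrad {d : ℕ} {E : Type*} [NormedAddCommGroup E] (𝒳 : Set E)
    (f : Param d → E → ℝ) (K₁ K₂ : ℝ) : Prop where
  differentiable : ∀ x ∈ 𝒳, Differentiable ℝ (fun θ => f θ x)
  bound : ∀ x ∈ 𝒳, ∀ x' ∈ 𝒳, ∀ θ θ' : Param d,
    ‖gradient (fun ϑ => f ϑ x) θ - gradient (fun ϑ => f ϑ x') θ'‖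
      ≤ K₁ * ‖θ - θ'‖ + K₂ * ‖x - x'‖ * (‖θ‖ + ‖θ'‖ + 1)

/-- Uniform dissipativity of the loss, for data in `𝒳`. -/
structure Dissipative {d : ℕ} {E : Type*} (𝒳 : Set E)
    (f : Param d → E → ℝ) (B m K : ℝ) : Prop where
  grad_zero : ∀ x ∈ 𝒳, ‖gradient (fun ϑ => f ϑ x) 0‖ ≤ B
  dissip : ∀ x ∈ 𝒳, ∀ θ₁ θ₂ : Param d,
    m * ‖θ₁ - θ₂‖ ^ 2 - K
      ≤ inner ℝ (gradient (fun ϑ => f ϑ x) θ₁ - gradient (fun ϑ => f ϑ x) θ₂) (θ₁ - θ₂)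

/-- Two data sets of size `n` that differ in at most one entry. -/
def Neighboring {n : ℕ} {E : Type*} (X X' : Fin n → E) : Prop :=
  ∃ i, ∀ j, j ≠ i → X j = X' j

/-- One step of noisy gradient descent on the objective `F`, started at `θ` with noise value `ξ`. -/
noncomputable def gdStep {d : ℕ} (η σ : ℝ) (F : Param d → ℝ) (θ ξ : Param d) : Param d :=
  θ - η • gradient F θ + σ • ξ

theorem measurable_gdStep {d : ℕ} (η σ : ℝ) (F : Param d → ℝ) :
    Measurable (Function.uncurry (gdStep η σ F)) := by
  have hg : Measurable (gradient F) :=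
    (InnerProductSpace.toDual ℝ (Param d)).symm.continuous.measurable.comp
      (measurable_fderiv ℝ F)
  unfold gdStep Function.uncurry
  exact (measurable_fst.sub ((hg.comp measurable_fst).const_smul η)).add
    (measurable_snd.const_smul σ)

/-- The transition kernel of `θ_k = θ_{k-1} - η ∇F(θ_{k-1}) + σ ξ_k` with i.i.d. noise `ξ_k ∼ ν`:
the measure at `θ` is the law of `θ - η ∇F(θ) + σ ξ` for `ξ ∼ ν`. -/
noncomputable def gdKernel {d : ℕ} (η σ : ℝ) (F : Param d → ℝ) (ν : Measure (Param d))
    [SFinite ν] : Kernel (Param d) (Param d) where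
  toFun θ := ν.map (gdStep η σ F θ)
  measurable' := by
    refine Measure.measurable_of_measurable_coe _ fun s hs => ?_
    have h : ∀ θ : Param d, ν.map (gdStep η σ F θ) s
        = ν (Prod.mk θ ⁻¹' (Function.uncurry (gdStep η σ F) ⁻¹' s)) := fun θ => by
      have hθ : Measurable (gdStep η σ F θ) :=
        (measurable_gdStep η σ F).comp measurable_prodMk_left
      rw [Measure.map_apply hθ hs]
      rfl
    simp_rw [h]
    exact measurable_measure_prodMk_left (measurable_gdStep η σ F hs)

/-- The `V`-norm `‖μ - ν‖_V`, the supremum of `|∫ g dμ - ∫ g dν|` over measurable `g` with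
`|g| ≤ V`. It is meant for `V` integrable with respect to both measures. -/
noncomputable def vNorm {d : ℕ} (V : Param d → ℝ) (μ ν : Measure (Param d)) : ℝ≥0∞ :=
  ⨆ (g : Param d → ℝ) (_ : Measurable g ∧ ∀ y, |g y| ≤ V y),
    ENNReal.ofReal |∫ y, g y ∂μ - ∫ y, g y ∂ν|

/-- The quantity `sup_θ ‖P(θ, ·) - P'(θ, ·)‖_V / V'(θ)` for positive `V'`. -/
noncomputable def kernelDist {d : ℕ} (V V' : Param d → ℝ) (P P' : Kernel (Param d) (Param d)) :
    ℝ≥0∞ :=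
  ⨆ θ : Param d, (vNorm V (P θ) (P' θ) / ENNReal.ofReal (V' θ))

/-- The Lyapunov function `θ ↦ (1 + ‖θ - c‖²)^(q/2)` centred at `c`. -/
noncomputable def lyap {d : ℕ} (q : ℝ) (c θ : Param d) : ℝ :=
  (1 + ‖θ - c‖ ^ 2) ^ (q / 2)

end NoisyGD

/-! The two kernels translate the same noise law `ν` by different drifts, `a = θ - η∇F(θ, X)` and
`a' = θ - η∇F(θ, X')`. The theorem therefore splits into a smoothing estimate for `ν`, in which a
translation changes means of test functions below `lyap p c` at most linearly
(`exists_stable_shift_bound_measurable`), and a bound of order `1 / n` on `a - a'`.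

For the smoothing, `ν` is viewed as a Gaussian mixture: it is the law of `√S • Z`, with `Z` Gaussian
and `S` an independent positive `α/2`-stable variable. A Gaussian of scale `t` satisfies the
estimate with constant of order `1 + t⁻¹` (`exists_gauss_shift_bound`), so averaging requires a
finite mean of `S^(-1/2)`. The variable `S` is never constructed. Normalised sums of Pareto
variables replace it: their Laplace transforms converge to `exp (-y^(α/2))`, their moments of order
`-1/2` are bounded uniformly (`exists_lintegral_inv_sqrt_paretoSum_le`), and the mixtures converge
weakly to `ν` by Lévy's continuity theorem. The estimate passes to the limit for bounded continuous
test functions, and then to measurable ones by `L¹` approximation, since `lyap p c` is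
`ν`-integrable for `p < α`.

For the drift, one changed entry moves the mean gradient by `O((1 + ‖θ‖) / n)`. Dissipativity
confines every stationary point to a fixed ball, so all distances are controlled by `W = √(1 + ‖θ -
θs'‖²)`. The shift contributes a factor `W / n` and the weights a factor `W^p`; together they give
the denominator `W^(1 + p)`. -/

namespace NoisyGD

/-! ### The Gaussian law -/

/-- Density of the centred Gaussian law with covariance `2 I`. -/
noncomputable def gaussDensity {d : ℕ} (z : Param d) : ℝ :=
  (4 * Real.pi) ^ (-((d : ℝ) / 2)) * Real.exp (-(1 / 4) * ‖z‖ ^ 2)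

theorem gaussDensity_nonneg {d : ℕ} (z : Param d) : 0 ≤ gaussDensity z := by
  unfold gaussDensity; positivity

theorem continuous_gaussDensity {d : ℕ} : Continuous (gaussDensity (d := d)) := by
  unfold gaussDensity; fun_prop

theorem integrable_exp_neg_mul_sq_norm {d : ℕ} {b : ℝ} (hb : 0 < b) :
    Integrable (fun z : Param d => Real.exp (-b * ‖z‖ ^ 2)) := by
  have h := (GaussianFourier.integrable_cexp_neg_mul_sq_norm_add (V := Param d) (b := (b : ℂ))
    (by simpa using hb) 0 0).norm
  refine h.congr (ae_of_all _ fun z => ?_)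
  simp [Complex.norm_exp, ← Complex.ofReal_pow]

theorem integrable_gaussDensity {d : ℕ} : Integrable (gaussDensity (d := d)) :=
  (integrable_exp_neg_mul_sq_norm (by norm_num)).const_mul _

theorem integral_gaussDensity {d : ℕ} : ∫ z : Param d, gaussDensity z = 1 := by
  unfold gaussDensity
  rw [integral_const_mul, GaussianFourier.integral_rexp_neg_mul_sq_norm (by norm_num)]
  rw [show Real.pi / (1 / 4) = 4 * Real.pi by ring, ← Real.rpow_add (by positivity)]
  simp

/-- The centred Gaussian law with covariance `2 I`. -/
noncomputable def gaussLaw (d : ℕ) : Measure (Param d) :=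
  volume.withDensity fun z => ENNReal.ofReal (gaussDensity z)

theorem integral_gaussLaw {d : ℕ} {G : Type*} [NormedAddCommGroup G] [NormedSpace ℝ G]
    (g : Param d → G) : ∫ z, g z ∂gaussLaw d = ∫ z, gaussDensity z • g z := by
  unfold gaussLaw
  rw [integral_withDensity_eq_integral_toReal_smul
    (continuous_gaussDensity.measurable.ennreal_ofReal) (by simp)]
  simp [ENNReal.toReal_ofReal (gaussDensity_nonneg _)]

instance isProbabilityMeasure_gaussLaw (d : ℕ) : IsProbabilityMeasure (gaussLaw d) where
  measure_univ := by
    unfold gaussLaw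
    rw [withDensity_apply _ MeasurableSet.univ, Measure.restrict_univ,
      ← ofReal_integral_eq_lintegral_ofReal integrable_gaussDensity
        (ae_of_all _ gaussDensity_nonneg), integral_gaussDensity, ENNReal.ofReal_one]

/-- Covariance `2 I` avoids a factor `1/2`: given the mixing value `s`, the vector `√s • Z` has
characteristic function `exp (-s‖u‖²)`, so a mixture has the Laplace transform of `s` at `‖u‖²`. -/
theorem charFun_gaussLaw {d : ℕ} (u : Param d) :
    charFun (gaussLaw d) u = ((Real.exp (-‖u‖ ^ 2) : ℝ) : ℂ) := by
  rw [charFun_apply, integral_gaussLaw]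
  have h := GaussianFourier.integral_cexp_neg_mul_sq_norm_add (V := Param d) (b := ((1 / 4 : ℝ) : ℂ))
    (by simp) Complex.I u
  have e : ∀ z : Param d, gaussDensity z • Complex.exp ((inner ℝ z u : ℝ) * Complex.I)
      = (((4 * Real.pi) ^ (-((d : ℝ) / 2)) : ℝ) : ℂ) *
        Complex.exp (-((1 / 4 : ℝ) : ℂ) * ‖z‖ ^ 2 + Complex.I * (inner ℝ u z : ℝ)) := fun z => by
    rw [gaussDensity, Complex.exp_add, Complex.real_smul, real_inner_comm]
    push_cast
    ring_nf
  simp_rw [e]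
  rw [integral_const_mul, h]
  have e2 : ((Real.pi : ℂ) / ((1 / 4 : ℝ) : ℂ)) ^ (Module.finrank ℝ (Param d) / 2 : ℂ)
      = (((4 * Real.pi) ^ ((d : ℝ) / 2) : ℝ) : ℂ) := by
    rw [Complex.ofReal_cpow (by positivity)]
    simp
    congr 1
    ring
  rw [e2, ← mul_assoc, ← Complex.ofReal_mul, ← Real.rpow_add (by positivity)]
  simp

/-! ### Gaussian smoothing: weighted effect of a translation -/

theorem hasDerivAt_gaussDensity_line {d : ℕ} (z v : Param d) (r : ℝ) :
    HasDerivAt (fun r : ℝ => gaussDensity (z - r • v))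
      (gaussDensity (z - r • v) * (1 / 2 * inner ℝ (z - r • v) v)) r := by
  have h1 : HasDerivAt (fun r : ℝ => z - r • v) (-v) r := by
    simpa using ((hasDerivAt_id r).smul_const v).const_sub z
  have h2 := ((h1.norm_sq.const_mul (-(1 / 4 : ℝ))).exp).const_mul
    ((4 * Real.pi) ^ (-((d : ℝ) / 2)))
  refine h2.congr_deriv ?_
  rw [gaussDensity, inner_neg_right]
  ring

/-- The fundamental theorem of calculus along `r ↦ z - r • v`, followed by Cauchy–Schwarz. The
extended nonnegative form is ready for Tonelli. -/
theorem ofReal_abs_gaussDensity_sub_le {d : ℕ} (z v : Param d) :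
    ENNReal.ofReal |gaussDensity z - gaussDensity (z - v)|
      ≤ ∫⁻ r in Set.Ioc (0 : ℝ) 1,
        ENNReal.ofReal (‖v‖ * (‖z - r • v‖ * gaussDensity (z - r • v))) := by
  have hc : Continuous fun r : ℝ =>
      gaussDensity (z - r • v) * (1 / 2 * inner ℝ (z - r • v) v) := by
    have := continuous_gaussDensity (d := d)
    fun_prop
  have hc' : Continuous fun r : ℝ => ‖v‖ * (‖z - r • v‖ * gaussDensity (z - r • v)) := by
    have := continuous_gaussDensity (d := d)
    fun_prop
  have h := intervalIntegral.integral_eq_sub_of_hasDerivAt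
    (f := fun r : ℝ => gaussDensity (z - r • v)) (a := 0) (b := 1)
    (fun r _ => hasDerivAt_gaussDensity_line z v r) (hc.intervalIntegrable 0 1)
  simp only [one_smul, zero_smul, sub_zero] at h
  rw [abs_sub_comm, ← h, ← ofReal_integral_eq_lintegral_ofReal]
  · apply ENNReal.ofReal_le_ofReal
    rw [← Real.norm_eq_abs, ← intervalIntegral.integral_of_le zero_le_one]
    refine intervalIntegral.norm_integral_le_of_norm_le zero_le_one (ae_of_all _ fun r _ => ?_)
      (hc'.intervalIntegrable 0 1)
    rw [norm_mul, norm_mul, Real.norm_of_nonneg (gaussDensity_nonneg _)]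
    have h1 := norm_inner_le_norm (𝕜 := ℝ) (z - r • v) v
    have h2 := gaussDensity_nonneg (z - r • v)
    have h3 : ‖(1 / 2 : ℝ)‖ ≤ 1 := by norm_num
    calc _ ≤ gaussDensity (z - r • v) * (1 * (‖z - r • v‖ * ‖v‖)) := by gcongr
      _ = _ := by ring
  · exact (hc'.integrableOn_Icc).mono_set Set.Ioc_subset_Icc_self
  · exact ae_of_all _ fun r => by have := gaussDensity_nonneg (z - r • v); positivity

/-- After Tonelli, translating by `r • v` moves the shift from the Gaussian factor to the weight. -/
theorem lintegral_mul_gaussDensity_sub_le {d : ℕ} (v : Param d) {W : Param d → ℝ≥0∞}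
    (hW : Measurable W) {A : ℝ≥0∞}
    (hA : ∀ r ∈ Set.Ioc (0 : ℝ) 1,
      ∫⁻ z, W (z + r • v) * ENNReal.ofReal (‖z‖ * gaussDensity z) ≤ A) :
    ∫⁻ z, W z * ENNReal.ofReal |gaussDensity z - gaussDensity (z - v)|
      ≤ ENNReal.ofReal ‖v‖ * A := by
  have hm : Measurable (gaussDensity (d := d)) := continuous_gaussDensity.measurable
  calc ∫⁻ z, W z * ENNReal.ofReal |gaussDensity z - gaussDensity (z - v)|
      ≤ ∫⁻ z, ∫⁻ r in Set.Ioc (0 : ℝ) 1,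
          W z * ENNReal.ofReal (‖v‖ * (‖z - r • v‖ * gaussDensity (z - r • v))) := by
        refine lintegral_mono fun z => ?_
        rw [lintegral_const_mul]
        · gcongr
          exact ofReal_abs_gaussDensity_sub_le z v
        · fun_prop
    _ = ∫⁻ r in Set.Ioc (0 : ℝ) 1, ∫⁻ z,
          W z * ENNReal.ofReal (‖v‖ * (‖z - r • v‖ * gaussDensity (z - r • v))) := by
        rw [lintegral_lintegral_swap]
        fun_prop
    _ ≤ ∫⁻ r in Set.Ioc (0 : ℝ) 1, ENNReal.ofReal ‖v‖ * A := by
        refine setLIntegral_mono measurable_const fun r hr => ?_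
        rw [← lintegral_add_right_eq_self _ (r • v)]
        simp only [add_sub_cancel_right]
        simp_rw [ENNReal.ofReal_mul (norm_nonneg v), mul_left_comm _ (ENNReal.ofReal ‖v‖)]
        rw [lintegral_const_mul _ (by fun_prop)]
        gcongr
        exact hA r hr
    _ = _ := by simp

theorem lyap_le {d : ℕ} {p : ℝ} (hp0 : 0 < p) (hp1 : p ≤ 1) (c y : Param d) :
    lyap p c y ≤ 1 + ‖y - c‖ ^ p := by
  unfold lyap
  have h := Real.rpow_add_le_add_rpow (p := p / 2) zero_le_one (sq_nonneg ‖y - c‖)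
    (by linarith) (by linarith)
  rw [Real.one_rpow, ← Real.rpow_natCast, ← Real.rpow_mul (norm_nonneg _)] at h
  convert h using 3
  · simp
  · push_cast; ring

theorem lyap_nonneg {d : ℕ} (p : ℝ) (c y : Param d) : 0 ≤ lyap p c y := by
  unfold lyap; positivity

theorem continuous_lyap {d : ℕ} (p : ℝ) (c : Param d) : Continuous (lyap p c) := by
  unfold lyap
  refine Continuous.rpow_const (by fun_prop) fun y => Or.inl ?_
  positivity

theorem rpow_add_three_le {p x y z : ℝ} (hp0 : 0 ≤ p) (hp1 : p ≤ 1) (hx : 0 ≤ x) (hy : 0 ≤ y)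
    (hz : 0 ≤ z) : (x + y + z) ^ p ≤ x ^ p + y ^ p + z ^ p :=
  (Real.rpow_add_le_add_rpow (by positivity) hz hp0 hp1).trans
    (add_le_add_left (Real.rpow_add_le_add_rpow hx hy hp0 hp1) _)

/-- Half of the Gaussian exponent absorbs the polynomial factor. -/
theorem integrable_weighted_gaussDensity {d : ℕ} {p : ℝ} (hp0 : 0 < p) (hp1 : p ≤ 1) :
    Integrable fun z : Param d => (1 + ‖z‖ ^ p) * (‖z‖ * gaussDensity z) := by
  have hi := (integrable_exp_neg_mul_sq_norm (d := d) (b := 1 / 8) (by norm_num)).const_mul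
    (16 * (4 * Real.pi) ^ (-((d : ℝ) / 2)))
  refine hi.mono' ?_ (ae_of_all _ fun z => ?_)
  · have := continuous_gaussDensity (d := d)
    have h2 : Continuous fun z : Param d => ‖z‖ ^ p :=
      continuous_norm.rpow_const fun _ => Or.inr hp0.le
    exact Continuous.aestronglyMeasurable (by fun_prop)
  · have h0 := norm_nonneg z
    rw [Real.norm_of_nonneg (by have := gaussDensity_nonneg z; positivity), gaussDensity]
    have h1 : ‖z‖ ^ p ≤ 1 + ‖z‖ := by
      have := Real.rpow_le_rpow h0 (by linarith : ‖z‖ ≤ 1 + ‖z‖) hp0.le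
      refine this.trans ?_
      simpa using Real.rpow_le_rpow_of_exponent_le (by linarith : 1 ≤ 1 + ‖z‖) hp1
    have h2 : (1 + ‖z‖ ^ p) * ‖z‖ ≤ 16 * Real.exp (1 / 8 * ‖z‖ ^ 2) := by
      have := Real.add_one_le_exp (1 / 8 * ‖z‖ ^ 2)
      nlinarith [sq_nonneg (‖z‖ - 1)]
    have h4 : Real.exp (1 / 8 * ‖z‖ ^ 2) * Real.exp (-(1 / 4) * ‖z‖ ^ 2)
        = Real.exp (-(1 / 8) * ‖z‖ ^ 2) := by
      rw [← Real.exp_add]; congr 1; ring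
    calc _ = (4 * Real.pi) ^ (-((d : ℝ) / 2)) *
          (((1 + ‖z‖ ^ p) * ‖z‖) * Real.exp (-(1 / 4) * ‖z‖ ^ 2)) := by ring
      _ ≤ (4 * Real.pi) ^ (-((d : ℝ) / 2)) *
          ((16 * Real.exp (1 / 8 * ‖z‖ ^ 2)) * Real.exp (-(1 / 4) * ‖z‖ ^ 2)) := by gcongr
      _ = _ := by rw [mul_assoc 16, h4]; ring

/-- Subadditivity of `x ↦ x^p` along a convex combination. The product form separates scale,
endpoints and noise, so that integration over `z` leaves only a constant. -/
theorem lyap_segment_le {d : ℕ} {p : ℝ} (hp0 : 0 < p) (hp1 : p ≤ 1) {c a a' z : Param d}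
    {r t : ℝ} (hr : r ∈ Set.Icc (0 : ℝ) 1) (ht : 0 < t) :
    lyap p c ((a + r • (a' - a)) + t • z)
      ≤ (1 + t ^ p) * (1 + ‖a - c‖ ^ p + ‖a' - c‖ ^ p) * (1 + ‖z‖ ^ p) := by
  refine (lyap_le hp0 hp1 _ _).trans ?_
  have e : a + r • (a' - a) + t • z - c = (1 - r) • (a - c) + r • (a' - c) + t • z := by
    module
  have hn : ‖a + r • (a' - a) + t • z - c‖ ≤ ‖a - c‖ + ‖a' - c‖ + t * ‖z‖ := by
    rw [e]
    refine (norm_add₃_le).trans ?_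
    rw [norm_smul, norm_smul, norm_smul, Real.norm_of_nonneg hr.1, Real.norm_of_nonneg ht.le,
      Real.norm_of_nonneg (by linarith [hr.2] : 0 ≤ 1 - r)]
    gcongr
    · exact mul_le_of_le_one_left (norm_nonneg _) (by linarith [hr.1])
    · exact mul_le_of_le_one_left (norm_nonneg _) hr.2
  have h := (Real.rpow_le_rpow (norm_nonneg _) hn hp0.le).trans
    (rpow_add_three_le hp0.le hp1 (norm_nonneg _) (norm_nonneg _) (by positivity))
  rw [Real.mul_rpow ht.le (norm_nonneg _)] at h
  have hx : 0 ≤ ‖a - c‖ ^ p := by positivity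
  have hy : 0 ≤ ‖a' - c‖ ^ p := by positivity
  have hz : 0 ≤ ‖z‖ ^ p := by positivity
  have ht' : 0 ≤ t ^ p := by positivity
  generalize ‖a - c‖ ^ p = x at *
  generalize ‖a' - c‖ ^ p = y at *
  generalize ‖z‖ ^ p = w at *
  generalize t ^ p = s at *
  calc _ ≤ 1 + x + y + s * w := by linarith
    _ ≤ (1 + x + y + s * w) + (s * (1 + x + y) + (1 + x + y) * w + s * (x + y) * w) :=
        le_add_of_nonneg_right (by positivity)
    _ = _ := by ring

theorem inv_mul_one_add_rpow_le {p t : ℝ} (hp0 : 0 ≤ p) (hp1 : p ≤ 1) (ht : 0 < t) :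
    t⁻¹ * (1 + t ^ p) ≤ 2 * (1 + t⁻¹) := by
  have h1 : t ^ p ≤ 1 + t := by
    refine (Real.rpow_le_rpow ht.le (by linarith : t ≤ 1 + t) hp0).trans ?_
    simpa using Real.rpow_le_rpow_of_exponent_le (by linarith : 1 ≤ 1 + t) hp1
  have h2 : t⁻¹ * (1 + t ^ p) ≤ t⁻¹ * (1 + (1 + t)) := by gcongr
  have h3 : t⁻¹ * (1 + (1 + t)) = 1 + 2 * t⁻¹ := by field_simp; ring
  linarith

/-- Measured in units of the scale `t`, the translation is `v = t⁻¹ • (a' - a)`; a change of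
variables puts it on the density, whence the factor `t⁻¹`. The bound `b` only secures integrability
and does not enter `M`. -/
theorem exists_gauss_shift_bound {d : ℕ} {p : ℝ} (hp0 : 0 < p) (hp1 : p ≤ 1) :
    ∃ M : ℝ, 0 ≤ M ∧ ∀ (h : Param d → ℝ) (b : ℝ) (c a a' : Param d) (t : ℝ), Measurable h →
      (∀ y, |h y| ≤ b) → (∀ y, |h y| ≤ lyap p c y) → 0 < t →
      |∫ z, h (a + t • z) ∂gaussLaw d - ∫ z, h (a' + t • z) ∂gaussLaw d|
        ≤ M * (1 + t⁻¹) * (‖a - a'‖ * (1 + ‖a - c‖ ^ p + ‖a' - c‖ ^ p)) := by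
  set M₀ := ∫ z : Param d, (1 + ‖z‖ ^ p) * (‖z‖ * gaussDensity z) with hM₀
  have hM₀n : 0 ≤ M₀ := integral_nonneg fun z => by
    have := gaussDensity_nonneg z
    show 0 ≤ (1 + ‖z‖ ^ p) * (‖z‖ * gaussDensity z)
    positivity
  refine ⟨2 * M₀, by positivity, fun h b c a a' t hh hb hV ht => ?_⟩
  set Q := 1 + ‖a - c‖ ^ p + ‖a' - c‖ ^ p with hQ
  have hQ1 : 1 ≤ Q := by
    have h1 : 0 ≤ ‖a - c‖ ^ p := by positivity
    have h2 : 0 ≤ ‖a' - c‖ ^ p := by positivity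
    linarith
  have htp : 0 ≤ t ^ p := by positivity
  set v : Param d := t⁻¹ • (a' - a) with hv
  set H : Param d → ℝ := fun z => h (a + t • z) with hH
  have hHm : Measurable H := by fun_prop
  have hHv : ∀ z, h (a' + t • z) = H (z + v) := fun z => by
    simp only [hH, hv, smul_add, smul_smul, mul_inv_cancel₀ ht.ne', one_smul]
    congr 1
    abel
  have hint : ∀ w : Param d, Integrable fun z => gaussDensity (z - w) * H z := fun w => by
    refine (integrable_gaussDensity.comp_sub_right w).mul_bdd (c := b)
      hHm.aestronglyMeasurable (ae_of_all _ fun z => ?_)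
    rw [Real.norm_eq_abs]
    exact hb _
  have key : ∫ z, h (a + t • z) ∂gaussLaw d - ∫ z, h (a' + t • z) ∂gaussLaw d
      = ∫ z, H z * (gaussDensity z - gaussDensity (z - v)) := by
    rw [integral_gaussLaw, integral_gaussLaw]
    simp_rw [hHv, smul_eq_mul]
    have h1 : ∫ z, gaussDensity z * H (z + v) = ∫ z, gaussDensity (z - v) * H z := by
      rw [← integral_add_right_eq_self (fun z => gaussDensity (z - v) * H z) v]
      simp
    have h0 := hint 0
    simp only [sub_zero] at h0
    rw [h1, ← integral_sub h0 (hint v)]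
    congr 1
    ext z
    ring
  have hbound : ∀ r ∈ Set.Ioc (0 : ℝ) 1,
      ∫⁻ z, ENNReal.ofReal |H (z + r • v)| * ENNReal.ofReal (‖z‖ * gaussDensity z)
        ≤ ENNReal.ofReal ((1 + t ^ p) * Q * M₀) := by
    intro r hr
    rw [hM₀, ← integral_const_mul, ofReal_integral_eq_lintegral_ofReal]
    · refine lintegral_mono fun z => ?_
      have hg := gaussDensity_nonneg z
      rw [← ENNReal.ofReal_mul (abs_nonneg _)]
      apply ENNReal.ofReal_le_ofReal
      refine (mul_le_mul_of_nonneg_right ((hV _).trans ?_) (by positivity)).trans_eq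
        (mul_assoc _ _ _)
      have e : a + t • (z + r • v) = (a + r • (a' - a)) + t • z := by
        simp only [hv, smul_add, smul_smul]
        rw [show t * (r * t⁻¹) = r by field_simp]
        module
      rw [e]
      exact lyap_segment_le hp0 hp1 ⟨hr.1.le, hr.2⟩ ht
    · exact (integrable_weighted_gaussDensity hp0 hp1).const_mul _
    · exact ae_of_all _ fun z => by have := gaussDensity_nonneg z; positivity
  have main := lintegral_mul_gaussDensity_sub_le v (W := fun z => ENNReal.ofReal |H z|)
    (by fun_prop) hbound
  have hfin : |∫ z, H z * (gaussDensity z - gaussDensity (z - v))|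
      ≤ ‖v‖ * ((1 + t ^ p) * Q * M₀) := by
    rw [← ENNReal.ofReal_le_ofReal_iff (by positivity), ENNReal.ofReal_mul (norm_nonneg v)]
    refine le_trans ?_ main
    rw [← Real.norm_eq_abs, ofReal_norm]
    refine (enorm_integral_le_lintegral_enorm _).trans (lintegral_mono fun z => ?_)
    rw [enorm_mul, Real.enorm_eq_ofReal_abs, Real.enorm_eq_ofReal_abs]
  rw [key]
  refine hfin.trans ?_
  have hvn : ‖v‖ = t⁻¹ * ‖a - a'‖ := by
    rw [hv, norm_smul, norm_inv, Real.norm_of_nonneg ht.le, norm_sub_rev]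
  rw [hvn]
  calc _ = t⁻¹ * (1 + t ^ p) * (M₀ * (‖a - a'‖ * Q)) := by ring
    _ ≤ 2 * (1 + t⁻¹) * (M₀ * (‖a - a'‖ * Q)) :=
        mul_le_mul_of_nonneg_right (inv_mul_one_add_rpow_le hp0.le hp1 ht)
          (mul_nonneg hM₀n (mul_nonneg (norm_nonneg _) (by linarith)))
    _ = _ := by ring

/-! ### Laplace transform of the Pareto law -/

open Filter Topology Set

/-- Laplace transform of the Pareto law with scale `1` and shape `β`. -/
noncomputable def paretoLaplace (β y : ℝ) : ℝ := ∫ x, Real.exp (-(y * x)) ∂paretoMeasure 1 β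

theorem ae_one_le_pareto (β : ℝ) : ∀ᵐ x ∂paretoMeasure 1 β, 1 ≤ x := by
  rw [ae_iff, paretoMeasure, withDensity_apply _ (by measurability)]
  have : {a : ℝ | ¬1 ≤ a} = Iio 1 := by ext; simp
  rw [this]
  exact lintegral_paretoPDF_of_le le_rfl

theorem integral_pareto {β : ℝ} (hβ : 0 < β) (g : ℝ → ℝ) :
    ∫ x, g x ∂paretoMeasure 1 β = ∫ x in Ioi (1 : ℝ), β * x ^ (-(β + 1)) * g x := by
  unfold paretoMeasure
  have hm : Measurable (paretoPDF 1 β) := (measurable_paretoPDFReal 1 β).ennreal_ofReal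
  rw [integral_withDensity_eq_integral_toReal_smul hm (by simp [paretoPDF]),
    ← integral_Ici_eq_integral_Ioi, ← integral_indicator measurableSet_Ici]
  congr 1
  ext x
  rw [paretoPDF, ENNReal.toReal_ofReal (paretoPDFReal_nonneg zero_le_one hβ.le x), paretoPDFReal]
  by_cases h : 1 ≤ x
  · rw [if_pos h, indicator_of_mem (by exact h)]
    simp
  · rw [if_neg h, indicator_of_notMem (by exact h)]
    simp

theorem integrable_exp_neg_pareto {β y : ℝ} (hβ : 0 < β) (hy : 0 ≤ y) :
    Integrable (fun x => Real.exp (-(y * x))) (paretoMeasure 1 β) := by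
  have := isProbabilityMeasure_paretoMeasure one_pos hβ
  refine (integrable_const (1 : ℝ)).mono' (by fun_prop) ?_
  filter_upwards [ae_one_le_pareto β] with x hx
  rw [Real.norm_of_nonneg (Real.exp_nonneg _)]
  exact Real.exp_le_one_iff.2 (by have : 0 ≤ y * x := by positivity
                                  linarith)

theorem paretoLaplace_nonneg (β y : ℝ) : 0 ≤ paretoLaplace β y :=
  integral_nonneg fun _ => Real.exp_nonneg _

/-- Near `0` the bound `1 - exp (-u) ≤ u` leaves `u^(-β)`, integrable because `β < 1`; at infinity
`u^(-(β + 1))` suffices. -/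
theorem integrableOn_one_sub_exp_mul_rpow {β : ℝ} (hβ : 0 < β) (hβ1 : β < 1) :
    IntegrableOn (fun u : ℝ => β * u ^ (-(β + 1)) * (1 - Real.exp (-u))) (Ioi 0) := by
  have hm : AEStronglyMeasurable (fun u : ℝ => β * u ^ (-(β + 1)) * (1 - Real.exp (-u))) :=
    Measurable.aestronglyMeasurable (by fun_prop)
  rw [← Ioc_union_Ioi_eq_Ioi zero_le_one]
  refine IntegrableOn.union ?_ ?_
  · have h1 : IntegrableOn (fun u : ℝ => u ^ (-β)) (Ioc 0 1) := by
      have := intervalIntegral.intervalIntegrable_rpow' (a := 0) (b := 1) (r := -β) (by linarith)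
      rwa [intervalIntegrable_iff_integrableOn_Ioc_of_le zero_le_one] at this
    refine (h1.const_mul β).mono' hm.restrict ?_
    filter_upwards [ae_restrict_mem measurableSet_Ioc] with u hu
    have hu0 : 0 < u := hu.1
    have h2 := Real.add_one_le_exp (-u)
    have h3 : Real.exp (-u) ≤ 1 := Real.exp_le_one_iff.2 (by linarith)
    rw [Real.norm_of_nonneg (mul_nonneg (by positivity) (by linarith)), mul_assoc]
    gcongr
    calc u ^ (-(β + 1)) * (1 - Real.exp (-u)) ≤ u ^ (-(β + 1)) * u := by gcongr; linarith
      _ = u ^ (-β) := by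
        rw [← Real.rpow_add_one hu0.ne']; congr 1; ring
  · have h1 : IntegrableOn (fun u : ℝ => u ^ (-(β + 1))) (Ioi 1) :=
      integrableOn_Ioi_rpow_of_lt (by linarith) one_pos
    refine (h1.const_mul β).mono' hm.restrict ?_
    filter_upwards [ae_restrict_mem measurableSet_Ioi] with u hu
    have hu0 : 0 < u := lt_trans one_pos hu
    have h3 : Real.exp (-u) ≤ 1 := Real.exp_le_one_iff.2 (by linarith)
    rw [Real.norm_of_nonneg (mul_nonneg (by positivity) (by linarith))]
    refine mul_le_of_le_one_right (by positivity) ?_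
    linarith [Real.exp_nonneg (-u)]

/-- The constant `c` with `1 - paretoLaplace β y ~ c * y ^ β` as `y → 0`. -/
noncomputable def paretoConst (β : ℝ) : ℝ :=
  ∫ u in Ioi (0 : ℝ), β * u ^ (-(β + 1)) * (1 - Real.exp (-u))

theorem paretoConst_pos {β : ℝ} (hβ : 0 < β) (hβ1 : β < 1) : 0 < paretoConst β := by
  unfold paretoConst
  have hpos : ∀ u ∈ Ioi (0 : ℝ), 0 < β * u ^ (-(β + 1)) * (1 - Real.exp (-u)) := fun u hu => by
    have hu0 : 0 < u := hu
    have h3 : Real.exp (-u) < 1 := Real.exp_lt_one_iff.2 (by linarith)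
    exact mul_pos (by positivity) (by linarith)
  rw [setIntegral_pos_iff_support_of_nonneg_ae
    ((ae_restrict_mem measurableSet_Ioi).mono fun u hu => (hpos u hu).le)
    (integrableOn_one_sub_exp_mul_rpow hβ hβ1)]
  have : Ioi (0 : ℝ) ⊆
      Function.support (fun u : ℝ => β * u ^ (-(β + 1)) * (1 - Real.exp (-u))) ∩ Ioi 0 :=
    fun u hu => ⟨(hpos u hu).ne', hu⟩
  exact lt_of_lt_of_le (by simp) (measure_mono this)

/-- The substitution `u = y * x` extracts `y^β` by homogeneity of the Pareto density. -/
theorem one_sub_paretoLaplace {β y : ℝ} (hβ : 0 < β) (hy : 0 < y) :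
    1 - paretoLaplace β y
      = y ^ β * ∫ u in Ioi y, β * u ^ (-(β + 1)) * (1 - Real.exp (-u)) := by
  have := isProbabilityMeasure_paretoMeasure one_pos hβ
  have h1 : 1 - paretoLaplace β y = ∫ x, (1 - Real.exp (-(y * x))) ∂paretoMeasure 1 β := by
    rw [integral_sub (integrable_const _) (integrable_exp_neg_pareto hβ hy.le), paretoLaplace]
    simp
  have h2 := integral_comp_mul_left_Ioi
    (fun u : ℝ => β * u ^ (-(β + 1)) * (1 - Real.exp (-u))) 1 hy
  rw [mul_one, smul_eq_mul, eq_inv_mul_iff_mul_eq₀ hy.ne'] at h2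
  rw [h1, integral_pareto hβ, ← h2, ← integral_const_mul, ← integral_const_mul]
  refine setIntegral_congr_fun measurableSet_Ioi fun x hx => ?_
  have hx0 : 0 < x := lt_trans one_pos hx
  have e : y ^ β * y * y ^ (-(β + 1)) = 1 := by
    rw [← Real.rpow_add_one hy.ne', ← Real.rpow_add hy]; simp
  simp only [Real.mul_rpow hy.le hx0.le]
  linear_combination (-(β * x ^ (-(β + 1)) * (1 - Real.exp (-(y * x))))) * e

theorem tendsto_integral_Ioi_paretoConst {β : ℝ} (hβ : 0 < β) (hβ1 : β < 1) {y : ℕ → ℝ}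
    (hy0 : ∀ n, 0 ≤ y n) (hy : Tendsto y atTop (𝓝 0)) :
    Tendsto (fun n => ∫ u in Ioi (y n), β * u ^ (-(β + 1)) * (1 - Real.exp (-u))) atTop
      (𝓝 (paretoConst β)) := by
  set g : ℝ → ℝ := fun u => β * u ^ (-(β + 1)) * (1 - Real.exp (-u)) with hg
  have hgi : IntegrableOn g (Ioi 0) := integrableOn_one_sub_exp_mul_rpow hβ hβ1
  have e : ∀ n, ∫ u in Ioi (y n), g u = ∫ u in Ioi 0, (Ioi (y n)).indicator g u := fun n => by
    rw [setIntegral_indicator measurableSet_Ioi, inter_eq_right.2 (Ioi_subset_Ioi (hy0 n))]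
  simp_rw [e]
  unfold paretoConst
  refine tendsto_integral_of_dominated_convergence (fun u => ‖g u‖) (fun n => ?_) hgi.norm
    (fun n => ae_of_all _ fun u => norm_indicator_le_norm_self _ _) ?_
  · exact hgi.1.indicator measurableSet_Ioi
  · filter_upwards [ae_restrict_mem measurableSet_Ioi] with u hu
    refine tendsto_const_nhds.congr' ?_
    filter_upwards [hy.eventually (gt_mem_nhds (show (0 : ℝ) < u from hu))] with n hn
    rw [indicator_of_mem (by exact hn)]

/-- The normalising factor of a sum of `n` independent Pareto variables. -/
noncomputable def paretoScale (β : ℝ) (n : ℕ) : ℝ := (paretoConst β * (n + 1)) ^ (-β⁻¹)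

theorem paretoScale_pos {β : ℝ} (hβ : 0 < β) (hβ1 : β < 1) (n : ℕ) : 0 < paretoScale β n := by
  have := paretoConst_pos hβ hβ1
  unfold paretoScale
  positivity

theorem paretoScale_rpow {β : ℝ} (hβ : 0 < β) (hβ1 : β < 1) (n : ℕ) :
    (n + 1) * paretoScale β n ^ β = (paretoConst β)⁻¹ := by
  have := paretoConst_pos hβ hβ1
  unfold paretoScale
  rw [← Real.rpow_mul (by positivity), neg_mul, inv_mul_cancel₀ hβ.ne', Real.rpow_neg_one]
  field_simp

theorem tendsto_paretoScale {β : ℝ} (hβ : 0 < β) (hβ1 : β < 1) :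
    Tendsto (paretoScale β) atTop (𝓝 0) := by
  have h1 : Tendsto (fun n : ℕ => paretoConst β * ((n : ℝ) + 1)) atTop atTop :=
    (tendsto_natCast_atTop_atTop.atTop_add tendsto_const_nhds).const_mul_atTop
      (paretoConst_pos hβ hβ1)
  exact (tendsto_rpow_neg_atTop (inv_pos.2 hβ)).comp h1

/-- The scale is chosen so that one factor is `1 - y^β / (n + 1)` to first order; the limit is the
Laplace transform of the positive `β`-stable law. -/
theorem tendsto_paretoLaplace_pow {β : ℝ} (hβ : 0 < β) (hβ1 : β < 1) {y : ℝ} (hy : 0 ≤ y) :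
    Tendsto (fun n : ℕ => paretoLaplace β (paretoScale β n * y) ^ (n + 1)) atTop
      (𝓝 (Real.exp (-(y ^ β)))) := by
  have := isProbabilityMeasure_paretoMeasure one_pos hβ
  rcases hy.eq_or_lt with rfl | hy
  · simp [paretoLaplace, Real.zero_rpow hβ.ne']
  have hc := paretoConst_pos hβ hβ1
  have h0 : Tendsto (fun n => paretoScale β n * y) atTop (𝓝 0) := by
    simpa using (tendsto_paretoScale hβ hβ1).mul_const y
  have h1 := tendsto_integral_Ioi_paretoConst hβ hβ1
    (fun n => (mul_pos (paretoScale_pos hβ hβ1 n) hy).le) h0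
  have h2 : Tendsto (fun n : ℕ => ((n : ℝ) + 1) * (1 - paretoLaplace β (paretoScale β n * y)))
      atTop (𝓝 (y ^ β)) := by
    have h3 := h1.const_mul ((paretoConst β)⁻¹ * y ^ β)
    rw [mul_right_comm, inv_mul_cancel₀ hc.ne', one_mul] at h3
    refine h3.congr fun n => ?_
    rw [one_sub_paretoLaplace hβ (mul_pos (paretoScale_pos hβ hβ1 n) hy),
      Real.mul_rpow (paretoScale_pos hβ hβ1 n).le hy.le, ← paretoScale_rpow hβ hβ1 n]
    ring
  -- shift the index to use the limit of `(1 + g n) ^ n`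
  have h4 := Real.tendsto_one_add_pow_exp_of_tendsto
    (g := fun n : ℕ => -(1 - paretoLaplace β (paretoScale β (n - 1) * y))) (t := -(y ^ β)) (by
      rw [← tendsto_add_atTop_iff_nat 1]
      refine h2.neg.congr fun n => ?_
      simp only [Nat.add_sub_cancel]
      push_cast
      ring)
  rw [← tendsto_add_atTop_iff_nat 1] at h4
  refine h4.congr fun n => ?_
  simp

/-- For `y ≤ 1` the integral in `one_sub_paretoLaplace` is at least its part over `u > 1`, where `1
- exp (-u) ≥ 1 - exp (-1)`. For `y ≥ 1` the Pareto variable is at least `1`, so the transform is at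
most `exp (-y)`. This form is stable under powers, which gives a bound uniform in `n`. -/
theorem paretoLaplace_le {β y : ℝ} (hβ : 0 < β) (hβ1 : β < 1) (hy : 0 ≤ y) :
    paretoLaplace β y ≤ Real.exp (-((1 - Real.exp (-1)) * y ^ β)) := by
  have hP := isProbabilityMeasure_paretoMeasure one_pos hβ
  have he : 0 < Real.exp (-1) := Real.exp_pos _
  have he1 : Real.exp (-1) < 1 := Real.exp_lt_one_iff.2 (by norm_num)
  rcases hy.eq_or_lt with rfl | hy
  · simp [paretoLaplace, Real.zero_rpow hβ.ne']
  rcases le_total y 1 with h1 | h1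
  · refine le_trans ?_ (Real.add_one_le_exp _)
    suffices 1 - Real.exp (-1) ≤ ∫ u in Ioi y, β * u ^ (-(β + 1)) * (1 - Real.exp (-u)) by
      have h2 := one_sub_paretoLaplace hβ hy
      have h3 := mul_le_mul_of_nonneg_left this (Real.rpow_nonneg hy.le β)
      linarith
    have hint := integrableOn_one_sub_exp_mul_rpow hβ hβ1
    have hone : ∫ u in Ioi (1 : ℝ), β * u ^ (-(β + 1)) * (1 - Real.exp (-1))
        = 1 - Real.exp (-1) := by
      rw [integral_mul_const, integral_const_mul, integral_Ioi_rpow_of_lt (by linarith) one_pos]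
      simp [hβ.ne']
    rw [← hone]
    calc _ ≤ ∫ u in Ioi (1 : ℝ), β * u ^ (-(β + 1)) * (1 - Real.exp (-u)) := by
          refine setIntegral_mono_on ?_ (hint.mono_set (Ioi_subset_Ioi zero_le_one))
            measurableSet_Ioi fun u hu => ?_
          · exact ((integrableOn_Ioi_rpow_of_lt (by linarith) one_pos).const_mul β).mul_const _
          · have hu0 : 0 < u := lt_trans one_pos hu
            have hu1 : 1 ≤ u := le_of_lt hu
            gcongr
      _ ≤ _ := by
          refine setIntegral_mono_set (hint.mono_set (Ioi_subset_Ioi hy.le)) ?_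
            (Ioi_subset_Ioi h1).eventuallyLE
          filter_upwards [ae_restrict_mem measurableSet_Ioi] with u hu
          have hu0 : 0 < u := lt_trans hy hu
          have h3 : Real.exp (-u) ≤ 1 := Real.exp_le_one_iff.2 (by linarith)
          exact mul_nonneg (by positivity) (by linarith)
  · have h2 : paretoLaplace β y ≤ Real.exp (-y) := by
      have h3 : paretoLaplace β y ≤ ∫ x, Real.exp (-y) ∂paretoMeasure 1 β := by
        refine integral_mono_ae (integrable_exp_neg_pareto hβ hy.le) (integrable_const _) ?_
        filter_upwards [ae_one_le_pareto β] with x hx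
        exact Real.exp_le_exp.2 (by nlinarith)
      simpa using h3
    refine h2.trans (Real.exp_le_exp.2 ?_)
    have h3 : y ^ β ≤ y := by
      simpa using Real.rpow_le_rpow_of_exponent_le h1 hβ1.le
    have h4 : 0 ≤ y ^ β := Real.rpow_nonneg hy.le _
    nlinarith

/-! ### Normalised Pareto sums and their negative moments -/

/-- The joint law of `n + 1` independent Pareto variables. -/
noncomputable def paretoPi (β : ℝ) (n : ℕ) : Measure (Fin (n + 1) → ℝ) :=
  Measure.pi fun _ => paretoMeasure 1 β

theorem isProbabilityMeasure_paretoPi {β : ℝ} (hβ : 0 < β) (n : ℕ) :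
    IsProbabilityMeasure (paretoPi β n) := by
  have := isProbabilityMeasure_paretoMeasure one_pos hβ
  unfold paretoPi
  infer_instance

/-- The normalised Pareto sum, which approximates the stable subordinator. -/
noncomputable def paretoSum (β : ℝ) (n : ℕ) (x : Fin (n + 1) → ℝ) : ℝ :=
  paretoScale β n * ∑ i, x i

theorem measurable_paretoSum (β : ℝ) (n : ℕ) : Measurable (paretoSum β n) := by
  unfold paretoSum; fun_prop

theorem ae_paretoSum_pos {β : ℝ} (hβ : 0 < β) (hβ1 : β < 1) (n : ℕ) :
    ∀ᵐ x ∂paretoPi β n, 0 < paretoSum β n x := by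
  have := isProbabilityMeasure_paretoMeasure one_pos hβ
  have h : ∀ᵐ x ∂paretoPi β n, ∀ i, 1 ≤ x i := by
    rw [ae_all_iff]
    exact fun i => (Measure.quasiMeasurePreserving_eval _ i).ae (ae_one_le_pareto β)
  filter_upwards [h] with x hx
  refine mul_pos (paretoScale_pos hβ hβ1 n) ?_
  exact Finset.sum_pos (fun i _ => lt_of_lt_of_le one_pos (hx i)) Finset.univ_nonempty

theorem integral_exp_neg_paretoSum {β : ℝ} (hβ : 0 < β) (n : ℕ) (y : ℝ) :
    ∫ x, Real.exp (-(y * paretoSum β n x)) ∂paretoPi β n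
      = paretoLaplace β (paretoScale β n * y) ^ (n + 1) := by
  have := isProbabilityMeasure_paretoMeasure one_pos hβ
  have h := integral_fintype_prod_eq_pow (ι := Fin (n + 1))
    (fun x : ℝ => Real.exp (-(paretoScale β n * y * x))) (μ := paretoMeasure 1 β)
  rw [Fintype.card_fin] at h
  rw [paretoLaplace, ← h, paretoPi]
  congr 1
  ext x
  rw [← Real.exp_sum, paretoSum, Finset.sum_neg_distrib, ← Finset.mul_sum]
  ring_nf

theorem integrable_exp_neg_paretoSum {β : ℝ} (hβ : 0 < β) (hβ1 : β < 1) (n : ℕ) {y : ℝ}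
    (hy : 0 ≤ y) : Integrable (fun x => Real.exp (-(y * paretoSum β n x))) (paretoPi β n) := by
  have := isProbabilityMeasure_paretoPi hβ n
  have hm := measurable_paretoSum β n
  refine (integrable_const (1 : ℝ)).mono' (by fun_prop) ?_
  filter_upwards [ae_paretoSum_pos hβ hβ1 n] with x hx
  rw [Real.norm_of_nonneg (Real.exp_nonneg _), Real.exp_le_one_iff]
  have : 0 ≤ y * paretoSum β n x := by positivity
  linarith

/-- The Gamma integral, which reduces negative moments to Laplace transforms. -/
theorem ofReal_inv_sqrt_eq_lintegral {s : ℝ} (hs : 0 < s) :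
    ENNReal.ofReal (√s)⁻¹ = ENNReal.ofReal (Real.Gamma (1 / 2))⁻¹ *
      ∫⁻ y in Ioi (0 : ℝ), ENNReal.ofReal (y ^ (-(1 / 2) : ℝ) * Real.exp (-(y * s))) := by
  have hG : 0 < Real.Gamma (1 / 2) := Real.Gamma_pos_of_pos (by norm_num)
  have h := Real.integral_rpow_mul_exp_neg_mul_Ioi (a := 1 / 2) (r := s) (by norm_num) hs
  rw [show (1 / 2 - 1 : ℝ) = -(1 / 2) by norm_num] at h
  simp_rw [mul_comm s] at h
  have hi : IntegrableOn (fun y : ℝ => y ^ (-(1 / 2) : ℝ) * Real.exp (-(y * s))) (Ioi 0) :=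
    Integrable.of_integral_ne_zero (by rw [h]; positivity)
  rw [← ofReal_integral_eq_lintegral_ofReal hi, h, ← ENNReal.ofReal_mul (by positivity)]
  · congr 1
    rw [Real.sqrt_eq_rpow, one_div s, Real.inv_rpow hs.le]
    field_simp
  · filter_upwards [ae_restrict_mem measurableSet_Ioi] with y hy
    have : (0 : ℝ) < y := hy
    positivity

theorem paretoLaplace_scale_pow_le {β : ℝ} (hβ : 0 < β) (hβ1 : β < 1) (n : ℕ) {y : ℝ}
    (hy : 0 ≤ y) : paretoLaplace β (paretoScale β n * y) ^ (n + 1)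
      ≤ Real.exp (-((1 - Real.exp (-1)) * (paretoConst β)⁻¹) * y ^ β) := by
  have hs := (paretoScale_pos hβ hβ1 n).le
  refine (pow_le_pow_left₀ (paretoLaplace_nonneg _ _)
    (paretoLaplace_le hβ hβ1 (mul_nonneg hs hy)) _).trans_eq ?_
  rw [← Real.exp_nat_mul, Real.mul_rpow hs hy, ← paretoScale_rpow hβ hβ1 n]
  congr 1
  push_cast
  ring

/-- The negative moments of order `1 / 2` of the normalised Pareto sums are uniformly bounded. -/
theorem exists_lintegral_inv_sqrt_paretoSum_le {β : ℝ} (hβ : 0 < β) (hβ1 : β < 1) :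
    ∃ A : ℝ, 0 ≤ A ∧ ∀ n,
      ∫⁻ x, ENNReal.ofReal (√(paretoSum β n x))⁻¹ ∂paretoPi β n ≤ ENNReal.ofReal A := by
  set b := (1 - Real.exp (-1)) * (paretoConst β)⁻¹ with hb
  have hb0 : 0 < b := by
    have h1 := paretoConst_pos hβ hβ1
    have h2 : Real.exp (-1) < 1 := Real.exp_lt_one_iff.2 (by norm_num)
    exact mul_pos (by linarith) (by positivity)
  have hint := integrableOn_rpow_mul_exp_neg_mul_rpow (s := -(1 / 2)) (by norm_num) hβ hb0
  set J := ∫ y in Ioi (0 : ℝ), y ^ (-(1 / 2) : ℝ) * Real.exp (-b * y ^ β) with hJ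
  have hpos : ∀ y ∈ Ioi (0 : ℝ), 0 ≤ y ^ (-(1 / 2) : ℝ) * Real.exp (-b * y ^ β) := fun y hy => by
    have : (0 : ℝ) < y := hy
    positivity
  have hJ0 : 0 ≤ J := setIntegral_nonneg measurableSet_Ioi hpos
  have hG : 0 < Real.Gamma (1 / 2) := Real.Gamma_pos_of_pos (by norm_num)
  refine ⟨(Real.Gamma (1 / 2))⁻¹ * J, by positivity, fun n => ?_⟩
  have := isProbabilityMeasure_paretoPi hβ n
  have hm := measurable_paretoSum β n
  have hms : Measurable fun q : (Fin (n + 1) → ℝ) × ℝ =>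
      ENNReal.ofReal (q.2 ^ (-(1 / 2) : ℝ) * Real.exp (-(q.2 * paretoSum β n q.1))) := by
    fun_prop
  -- Tonelli turns the moment into the integral of the Laplace transform against `y^(-1/2)`, and the
  -- stretched exponential bounding that transform does not depend on `n`.
  calc ∫⁻ x, ENNReal.ofReal (√(paretoSum β n x))⁻¹ ∂paretoPi β n
      = ∫⁻ x, (ENNReal.ofReal (Real.Gamma (1 / 2))⁻¹ * ∫⁻ y in Ioi (0 : ℝ),
          ENNReal.ofReal (y ^ (-(1 / 2) : ℝ) * Real.exp (-(y * paretoSum β n x))))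
          ∂paretoPi β n := by
        refine lintegral_congr_ae ?_
        filter_upwards [ae_paretoSum_pos hβ hβ1 n] with x hx
        exact ofReal_inv_sqrt_eq_lintegral hx
    _ = ENNReal.ofReal (Real.Gamma (1 / 2))⁻¹ * ∫⁻ y in Ioi (0 : ℝ), ∫⁻ x,
          ENNReal.ofReal (y ^ (-(1 / 2) : ℝ) * Real.exp (-(y * paretoSum β n x)))
          ∂paretoPi β n := by
        rw [lintegral_const_mul _ hms.lintegral_prod_right', lintegral_lintegral_swap]
        exact hms.aemeasurable
    _ ≤ ENNReal.ofReal (Real.Gamma (1 / 2))⁻¹ * ∫⁻ y in Ioi (0 : ℝ),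
          ENNReal.ofReal (y ^ (-(1 / 2) : ℝ) * Real.exp (-b * y ^ β)) := by
        gcongr 1
        refine setLIntegral_mono (by fun_prop) fun y hy => ?_
        have hy0 : (0 : ℝ) < y := hy
        rw [← ofReal_integral_eq_lintegral_ofReal
          ((integrable_exp_neg_paretoSum hβ hβ1 n hy0.le).const_mul _)
          (ae_of_all _ fun x => by positivity), integral_const_mul, integral_exp_neg_paretoSum hβ]
        apply ENNReal.ofReal_le_ofReal
        gcongr
        exact paretoLaplace_scale_pow_le hβ hβ1 n hy0.le
    _ = _ := by
        rw [← ofReal_integral_eq_lintegral_ofReal hint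
          ((ae_restrict_mem measurableSet_Ioi).mono hpos), ← ENNReal.ofReal_mul (by positivity)]

/-! ### Gaussian mixtures and smoothing by the stable law -/

/-- The Gaussian mixture directed by the normalised Pareto sum. -/
noncomputable def stableApprox (d : ℕ) (β : ℝ) (n : ℕ) : Measure (Param d) :=
  ((paretoPi β n).prod (gaussLaw d)).map fun q => √(paretoSum β n q.1) • q.2

theorem measurable_sqrt_paretoSum_smul {d : ℕ} (β : ℝ) (n : ℕ) :
    Measurable fun q : (Fin (n + 1) → ℝ) × Param d => √(paretoSum β n q.1) • q.2 := by
  have := measurable_paretoSum β n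
  fun_prop

theorem isProbabilityMeasure_stableApprox {d : ℕ} {β : ℝ} (hβ : 0 < β) (n : ℕ) :
    IsProbabilityMeasure (stableApprox d β n) := by
  have := isProbabilityMeasure_paretoPi hβ n
  exact Measure.isProbabilityMeasure_map (measurable_sqrt_paretoSum_smul β n).aemeasurable

theorem integral_stableApprox {d : ℕ} {β : ℝ} (hβ : 0 < β) (n : ℕ) {G : Type*}
    [NormedAddCommGroup G] [NormedSpace ℝ G] {g : Param d → G} (hg : StronglyMeasurable g) {b : ℝ}
    (hb : ∀ y, ‖g y‖ ≤ b) :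
    Integrable (fun x => ∫ z, g (√(paretoSum β n x) • z) ∂gaussLaw d) (paretoPi β n) ∧
    ∫ y, g y ∂stableApprox d β n
      = ∫ x, ∫ z, g (√(paretoSum β n x) • z) ∂gaussLaw d ∂paretoPi β n := by
  have := isProbabilityMeasure_paretoPi hβ n
  have hi : Integrable (fun q : (Fin (n + 1) → ℝ) × Param d => g (√(paretoSum β n q.1) • q.2))
      ((paretoPi β n).prod (gaussLaw d)) :=
    (integrable_const b).mono'
      (hg.comp_measurable (measurable_sqrt_paretoSum_smul β n)).aestronglyMeasurable
      (ae_of_all _ fun q => hb _)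
  refine ⟨hi.integral_prod_left, ?_⟩
  rw [stableApprox, integral_map (measurable_sqrt_paretoSum_smul β n).aemeasurable
    hg.aestronglyMeasurable, integral_prod _ hi]

theorem charFun_stableApprox {d : ℕ} {β : ℝ} (hβ : 0 < β) (hβ1 : β < 1) (n : ℕ) (u : Param d) :
    charFun (stableApprox d β n) u
      = ((paretoLaplace β (paretoScale β n * ‖u‖ ^ 2) ^ (n + 1) : ℝ) : ℂ) := by
  rw [charFun_apply, (integral_stableApprox hβ n (b := 1)
    (Measurable.stronglyMeasurable (by fun_prop)) (fun y => by simp [Complex.norm_exp])).2,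
    ← integral_exp_neg_paretoSum hβ, ← integral_complex_ofReal]
  refine integral_congr_ae ?_
  filter_upwards [ae_paretoSum_pos hβ hβ1 n] with x hx
  have h := charFun_gaussLaw (√(paretoSum β n x) • u)
  rw [norm_smul, mul_pow, Real.norm_of_nonneg (Real.sqrt_nonneg _), Real.sq_sqrt hx.le] at h
  rw [mul_comm (‖u‖ ^ 2), ← h, charFun_apply]
  simp_rw [real_inner_smul_left, real_inner_smul_right]

/-- Lévy's continuity theorem: the index is `α / 2` because the Laplace transforms are evaluated at
`‖u‖ ^ 2`. -/
theorem tendsto_integral_stableApprox {d : ℕ} {α : ℝ} (hα : α ∈ Ioo (0 : ℝ) 2)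
    {ν : Measure (Param d)} [IsProbabilityMeasure ν] (hν : IsRotInvStable α ν)
    (g : BoundedContinuousFunction (Param d) ℝ) :
    Tendsto (fun n => ∫ y, g y ∂stableApprox d (α / 2) n) atTop (𝓝 (∫ y, g y ∂ν)) := by
  have hβ : 0 < α / 2 := by linarith [hα.1]
  have hβ1 : α / 2 < 1 := by linarith [hα.2]
  have hP := fun n => isProbabilityMeasure_stableApprox (d := d) hβ n
  let μ : ℕ → ProbabilityMeasure (Param d) := fun n => ⟨stableApprox d (α / 2) n, hP n⟩
  let μ₀ : ProbabilityMeasure (Param d) := ⟨ν, inferInstance⟩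
  have h : Tendsto μ atTop (𝓝 μ₀) := by
    refine ProbabilityMeasure.tendsto_iff_tendsto_charFun.2 fun u => ?_
    show Tendsto (fun n => charFun (stableApprox d (α / 2) n) u) atTop (𝓝 (charFun ν u))
    rw [hν u]
    simp_rw [charFun_stableApprox hβ hβ1]
    have h1 := tendsto_paretoLaplace_pow hβ hβ1 (sq_nonneg ‖u‖)
    have e : (‖u‖ ^ 2) ^ (α / 2) = ‖u‖ ^ α := by
      rw [← Real.rpow_natCast, ← Real.rpow_mul (norm_nonneg _)]
      congr 1
      push_cast
      ring
    rw [e] at h1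
    exact (Complex.continuous_ofReal.tendsto _).comp h1
  exact ProbabilityMeasure.tendsto_iff_forall_integral_tendsto.1 h g

/-- Smoothing by the stable law: a shift of a bounded continuous test function dominated by `lyap`
changes its mean at most linearly in the shift. -/
theorem exists_stable_shift_bound {d : ℕ} {α p σ : ℝ} (hα : α ∈ Ioo (0 : ℝ) 2) (hp0 : 0 < p)
    (hp1 : p ≤ 1) (hσ : 0 < σ)
    {ν : Measure (Param d)} [IsProbabilityMeasure ν] (hν : IsRotInvStable α ν) :
    ∃ M : ℝ, 0 ≤ M ∧ ∀ (h : BoundedContinuousFunction (Param d) ℝ) (c a a' : Param d),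
      (∀ y, |h y| ≤ lyap p c y) →
      |∫ z, h (a + σ • z) ∂ν - ∫ z, h (a' + σ • z) ∂ν|
        ≤ M * (‖a - a'‖ * (1 + ‖a - c‖ ^ p + ‖a' - c‖ ^ p)) := by
  have hβ : 0 < α / 2 := by linarith [hα.1]
  have hβ1 : α / 2 < 1 := by linarith [hα.2]
  obtain ⟨M, hM, hMb⟩ := exists_gauss_shift_bound (d := d) hp0 hp1
  obtain ⟨A, hA, hAb⟩ := exists_lintegral_inv_sqrt_paretoSum_le hβ hβ1
  -- Given the mixing value `s`, the Gaussian scale is `σ√s`; averaging `1 + (σ√s)⁻¹` gives at most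
  -- `1 + σ⁻¹ * A` for every `n`.
  refine ⟨M * (1 + σ⁻¹ * A), by positivity, fun h c a a' hV => ?_⟩
  set Q := ‖a - a'‖ * (1 + ‖a - c‖ ^ p + ‖a' - c‖ ^ p) with hQ
  have hQ0 : 0 ≤ Q := by positivity
  let S : Param d → BoundedContinuousFunction (Param d) ℝ := fun w =>
    h.compContinuous ⟨fun z => w + σ • z, by fun_prop⟩
  have hlim := (tendsto_integral_stableApprox hα hν (S a)).sub
    (tendsto_integral_stableApprox hα hν (S a'))
  refine le_of_tendsto hlim.abs (Eventually.of_forall fun n => ?_)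
  have hP := isProbabilityMeasure_paretoPi hβ n
  have hi := fun w => integral_stableApprox hβ n (S w).continuous.stronglyMeasurable
    (S w).norm_coe_le_norm
  rw [(hi a).2, (hi a').2, ← integral_sub (hi a).1 (hi a').1,
    ← ENNReal.ofReal_le_ofReal_iff (by positivity), ← Real.norm_eq_abs, ofReal_norm]
  refine (enorm_integral_le_lintegral_enorm _).trans ?_
  have hms := measurable_paretoSum (α / 2) n
  calc _ ≤ ∫⁻ x, ENNReal.ofReal (M * Q) * (1 + ENNReal.ofReal σ⁻¹ *
            ENNReal.ofReal (√(paretoSum (α / 2) n x))⁻¹) ∂paretoPi (α / 2) n := by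
        refine lintegral_mono_ae ?_
        filter_upwards [ae_paretoSum_pos hβ hβ1 n] with x hx
        have hs : 0 < √(paretoSum (α / 2) n x) := Real.sqrt_pos.2 hx
        rw [← ENNReal.ofReal_mul (by positivity), ← ENNReal.ofReal_one,
          ← ENNReal.ofReal_add zero_le_one (by positivity), ← ENNReal.ofReal_mul (by positivity),
          Real.enorm_eq_ofReal_abs]
        apply ENNReal.ofReal_le_ofReal
        have h1 := hMb h ‖h‖ c a a' (σ * √(paretoSum (α / 2) n x)) h.continuous.measurable
          h.norm_coe_le_norm hV (by positivity)
        have e : ∀ w : Param d, ∫ z, S w (√(paretoSum (α / 2) n x) • z) ∂gaussLaw d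
            = ∫ z, h (w + (σ * √(paretoSum (α / 2) n x)) • z) ∂gaussLaw d := fun w => by
          simp only [S, BoundedContinuousFunction.compContinuous_apply, ContinuousMap.coe_mk,
            smul_smul]
        rw [e, e]
        refine h1.trans_eq ?_
        rw [mul_inv]
        ring
    _ = ENNReal.ofReal (M * Q) * (1 + ENNReal.ofReal σ⁻¹ *
          ∫⁻ x, ENNReal.ofReal (√(paretoSum (α / 2) n x))⁻¹ ∂paretoPi (α / 2) n) := by
        rw [lintegral_const_mul _ (by fun_prop), lintegral_add_left measurable_const,
          lintegral_const_mul _ (by fun_prop)]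
        simp
    _ ≤ ENNReal.ofReal (M * Q) * (1 + ENNReal.ofReal σ⁻¹ * ENNReal.ofReal A) := by
        gcongr
        exact hAb n
    _ = _ := by
        rw [← ENNReal.ofReal_mul (by positivity), ← ENNReal.ofReal_one,
          ← ENNReal.ofReal_add zero_le_one (by positivity), ← ENNReal.ofReal_mul (by positivity)]
        congr 1
        ring

/-! ### Moments of order `p < α` of the stable law -/

/-- The range `1/|x| < t ≤ 2/|x|` alone is enough: there `1 ≤ t|x| ≤ 2`, so `1 - cos (t * x) ≥ 4/9`.
-/
theorem exists_rpow_abs_le_lintegral_one_sub_cos {p : ℝ} (hp : 0 < p) :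
    ∃ c : ℝ, 0 < c ∧ ∀ x : ℝ, ENNReal.ofReal (c * |x| ^ p)
      ≤ ∫⁻ t in Ioi (0 : ℝ), ENNReal.ofReal (t ^ (-(1 + p)) * (1 - Real.cos (t * x))) := by
  refine ⟨2 ^ (-(1 + p)) * (4 / 9), by positivity, fun x => ?_⟩
  rcases eq_or_ne x 0 with rfl | hx
  · simp [Real.zero_rpow hp.ne']
  have hx0 : 0 < |x| := abs_pos.2 hx
  have hsub : Ioc (1 / |x|) (2 / |x|) ⊆ Ioi (0 : ℝ) := fun t ht =>
    lt_trans (by positivity) ht.1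
  calc ENNReal.ofReal (2 ^ (-(1 + p)) * (4 / 9) * |x| ^ p)
      = ∫⁻ _ in Ioc (1 / |x|) (2 / |x|), ENNReal.ofReal ((2 / |x|) ^ (-(1 + p)) * (4 / 9)) := by
        rw [setLIntegral_const, Real.volume_Ioc, ← ENNReal.ofReal_mul (by positivity)]
        congr 1
        rw [Real.div_rpow (by norm_num) hx0.le, Real.rpow_neg hx0.le, Real.rpow_add hx0,
          Real.rpow_one]
        field_simp
        ring
    _ ≤ ∫⁻ t in Ioc (1 / |x|) (2 / |x|),
          ENNReal.ofReal (t ^ (-(1 + p)) * (1 - Real.cos (t * x))) := by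
        refine setLIntegral_mono (by fun_prop) fun t ht => ENNReal.ofReal_le_ofReal ?_
        have ht0 : 0 < t := hsub ht
        have h1 : 1 ≤ t * |x| := by
          have := ht.1.le
          rwa [div_le_iff₀ hx0] at this
        have h2 : t * |x| ≤ 2 := by
          have := ht.2
          rwa [le_div_iff₀ hx0] at this
        have h3 : Real.cos (t * x) ≤ 5 / 9 := by
          rw [← Real.cos_abs, abs_mul, abs_of_pos ht0]
          refine (Real.cos_le_cos_of_nonneg_of_le_pi zero_le_one ?_ h1).trans Real.cos_one_le
          linarith [Real.pi_gt_three]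
        have h4 : (2 / |x|) ^ (-(1 + p)) ≤ t ^ (-(1 + p)) :=
          Real.rpow_le_rpow_of_nonpos ht0 ht.2 (by linarith)
        gcongr
        linarith
    _ ≤ _ := lintegral_mono_set hsub

theorem lintegral_rpow_mul_one_sub_exp_lt_top {p α : ℝ} (hp : 0 < p) (hpα : p < α) :
    ∫⁻ t in Ioi (0 : ℝ), ENNReal.ofReal (t ^ (-(1 + p)) * (1 - Real.exp (-(t ^ α)))) < ∞ := by
  suffices h : IntegrableOn (fun t : ℝ => t ^ (-(1 + p)) * (1 - Real.exp (-(t ^ α)))) (Ioi 0) by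
    exact h.lintegral_lt_top
  have hm : AEStronglyMeasurable (fun t : ℝ => t ^ (-(1 + p)) * (1 - Real.exp (-(t ^ α)))) :=
    Measurable.aestronglyMeasurable (by fun_prop)
  have hle : ∀ t : ℝ, 0 < t → Real.exp (-(t ^ α)) ≤ 1 := fun t ht => by
    have : 0 ≤ t ^ α := by positivity
    exact Real.exp_le_one_iff.2 (by linarith)
  rw [← Ioc_union_Ioi_eq_Ioi zero_le_one]
  refine IntegrableOn.union ?_ ?_
  · have h1 : IntegrableOn (fun t : ℝ => t ^ (α - (1 + p))) (Ioc 0 1) := by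
      have := intervalIntegral.intervalIntegrable_rpow' (a := 0) (b := 1) (r := α - (1 + p))
        (by linarith)
      rwa [intervalIntegrable_iff_integrableOn_Ioc_of_le zero_le_one] at this
    refine h1.mono' hm.restrict ?_
    filter_upwards [ae_restrict_mem measurableSet_Ioc] with t ht
    have ht0 : 0 < t := ht.1
    have h2 := Real.add_one_le_exp (-(t ^ α))
    have h3 := hle t ht0
    rw [Real.norm_of_nonneg (mul_nonneg (by positivity) (by linarith))]
    calc t ^ (-(1 + p)) * (1 - Real.exp (-(t ^ α))) ≤ t ^ (-(1 + p)) * t ^ α := by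
          gcongr; linarith
      _ = t ^ (α - (1 + p)) := by rw [← Real.rpow_add ht0]; congr 1; ring
  · have h1 : IntegrableOn (fun t : ℝ => t ^ (-(1 + p))) (Ioi 1) :=
      integrableOn_Ioi_rpow_of_lt (by linarith) one_pos
    refine h1.mono' hm.restrict ?_
    filter_upwards [ae_restrict_mem measurableSet_Ioi] with t ht
    have ht0 : 0 < t := lt_trans one_pos ht
    have h3 := hle t ht0
    rw [Real.norm_of_nonneg (mul_nonneg (by positivity) (by linarith))]
    refine mul_le_of_le_one_right (by positivity) ?_
    linarith [Real.exp_nonneg (-(t ^ α))]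

theorem integral_cos_inner {d : ℕ} {α : ℝ} {ν : Measure (Param d)} [IsProbabilityMeasure ν]
    (hν : IsRotInvStable α ν) (u : Param d) :
    ∫ z, Real.cos (inner ℝ z u) ∂ν = Real.exp (-(‖u‖ ^ α)) := by
  have h := hν u
  rw [charFun_apply] at h
  have hi : Integrable (fun z : Param d => Complex.exp ((inner ℝ z u : ℝ) * Complex.I)) ν :=
    (integrable_const (1 : ℝ)).mono' (Measurable.aestronglyMeasurable (by fun_prop))
      (ae_of_all _ fun z => by simp [Complex.norm_exp])
  have h2 := Complex.reCLM.integral_comp_comm hi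
  rw [h, Complex.reCLM_apply, Complex.ofReal_re] at h2
  simpa only [Complex.reCLM_apply, Complex.exp_ofReal_mul_I_re] using h2

/-- Averaging the cosine representation over `ν` replaces the cosine by `exp (-t^α)`; the resulting
integral converges at `0` exactly because `p < α`. -/
theorem integrable_rpow_abs_inner {d : ℕ} {p α : ℝ} (hp : 0 < p) (hpα : p < α)
    {ν : Measure (Param d)} [IsProbabilityMeasure ν] (hν : IsRotInvStable α ν) {e : Param d}
    (he : ‖e‖ = 1) : Integrable (fun z => |inner ℝ z e| ^ p) ν := by
  obtain ⟨c, hc, hcb⟩ := exists_rpow_abs_le_lintegral_one_sub_cos hp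
  have hm : Measurable fun q : Param d × ℝ =>
      ENNReal.ofReal (q.2 ^ (-(1 + p)) * (1 - Real.cos (q.2 * inner ℝ q.1 e))) := by fun_prop
  suffices h : Integrable (fun z => c * |inner ℝ z e| ^ p) ν by
    refine (h.const_mul c⁻¹).congr (ae_of_all _ fun z => ?_)
    field_simp
  refine ⟨Measurable.aestronglyMeasurable (by fun_prop), ?_⟩
  rw [hasFiniteIntegral_iff_ofReal (ae_of_all _ fun z => by positivity)]
  calc ∫⁻ z, ENNReal.ofReal (c * |inner ℝ z e| ^ p) ∂ν
      ≤ ∫⁻ z, (∫⁻ t in Ioi (0 : ℝ),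
          ENNReal.ofReal (t ^ (-(1 + p)) * (1 - Real.cos (t * inner ℝ z e)))) ∂ν :=
        lintegral_mono fun z => hcb _
    _ = ∫⁻ t in Ioi (0 : ℝ), ∫⁻ z,
          ENNReal.ofReal (t ^ (-(1 + p)) * (1 - Real.cos (t * inner ℝ z e))) ∂ν :=
        lintegral_lintegral_swap hm.aemeasurable
    _ = ∫⁻ t in Ioi (0 : ℝ), ENNReal.ofReal (t ^ (-(1 + p)) * (1 - Real.exp (-(t ^ α)))) := by
        refine setLIntegral_congr_fun measurableSet_Ioi fun t ht => ?_
        have ht0 : 0 < t := ht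
        have hi : Integrable (fun z => Real.cos (t * inner ℝ z e)) ν :=
          (integrable_const (1 : ℝ)).mono' (Measurable.aestronglyMeasurable (by fun_prop))
            (ae_of_all _ fun z => Real.abs_cos_le_one _)
        have hcos := integral_cos_inner hν (t • e)
        rw [norm_smul, he, mul_one, Real.norm_of_nonneg ht0.le] at hcos
        simp_rw [real_inner_smul_right] at hcos
        have hi1 : Integrable (fun z => 1 - Real.cos (t * inner ℝ z e)) ν :=
          (integrable_const 1).sub hi
        rw [← ofReal_integral_eq_lintegral_ofReal (hi1.const_mul _) (ae_of_all _ fun z =>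
            mul_nonneg (by positivity) (sub_nonneg.2 (Real.cos_le_one _))),
          integral_const_mul, integral_sub (integrable_const 1) hi, hcos]
        simp
    _ < ∞ := lintegral_rpow_mul_one_sub_exp_lt_top hp hpα

theorem norm_rpow_add_le {F : Type*} [SeminormedAddCommGroup F] {p : ℝ} (hp0 : 0 ≤ p)
    (hp1 : p ≤ 1) (x y : F) : ‖x + y‖ ^ p ≤ ‖x‖ ^ p + ‖y‖ ^ p :=
  (Real.rpow_le_rpow (norm_nonneg _) (norm_add_le x y) hp0).trans
    (Real.rpow_add_le_add_rpow (norm_nonneg _) (norm_nonneg _) hp0 hp1)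

theorem integrable_norm_rpow {d : ℕ} {p α : ℝ} (hp : 0 < p) (hp1 : p ≤ 1) (hpα : p < α)
    {ν : Measure (Param d)} [IsProbabilityMeasure ν] (hν : IsRotInvStable α ν) :
    Integrable (fun z => ‖z‖ ^ p) ν := by
  let b := EuclideanSpace.basisFun (Fin d) ℝ
  have hi : Integrable (fun z => ∑ i, |inner ℝ z (b i)| ^ p) ν :=
    integrable_finsetSum _ fun i _ =>
      integrable_rpow_abs_inner hp hpα hν (b.orthonormal.1 i)
  refine hi.mono' (Measurable.aestronglyMeasurable (by fun_prop)) (ae_of_all _ fun z => ?_)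
  rw [Real.norm_of_nonneg (by positivity)]
  calc ‖z‖ ^ p = ‖∑ i, b.repr z i • b i‖ ^ p := by rw [b.sum_repr]
    _ ≤ ∑ i, ‖b.repr z i • b i‖ ^ p :=
        Finset.le_sum_of_subadditive (fun w : Param d => ‖w‖ ^ p)
          (by simp [Real.zero_rpow hp.ne']) (norm_rpow_add_le hp.le hp1) _ _
    _ = _ := by
        refine Finset.sum_congr rfl fun i _ => ?_
        rw [norm_smul, b.orthonormal.1 i, mul_one, b.repr_apply_apply, real_inner_comm,
          Real.norm_eq_abs]

theorem integrable_lyap_add_smul {d : ℕ} {p α : ℝ} (hp : 0 < p) (hp1 : p ≤ 1) (hpα : p < α)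
    {ν : Measure (Param d)} [IsProbabilityMeasure ν] (hν : IsRotInvStable α ν)
    (c a : Param d) (σ : ℝ) : Integrable (fun z => lyap p c (a + σ • z)) ν := by
  have hi := (integrable_const (1 + ‖a - c‖ ^ p)).add
    ((integrable_norm_rpow hp hp1 hpα hν).const_mul (‖σ‖ ^ p))
  have hc := continuous_lyap p c
  refine hi.mono' (Continuous.aestronglyMeasurable (by fun_prop)) (ae_of_all _ fun z => ?_)
  rw [Real.norm_of_nonneg (lyap_nonneg _ _ _)]
  refine (lyap_le hp hp1 _ _).trans ?_
  have h := norm_rpow_add_le hp.le hp1 (a - c) (σ • z)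
  rw [norm_smul, Real.mul_rpow (norm_nonneg _) (norm_nonneg _),
    show a - c + σ • z = a + σ • z - c by abel] at h
  simp only [Pi.add_apply]
  linarith

/-! ### From continuous to measurable test functions -/

/-- A bound on `|∫ h dμ - ∫ h dμ'|` for bounded continuous `h` with `|h| ≤ V` extends to measurable
`h` with `|h| ≤ V`, when `V` is continuous and integrable. -/
theorem abs_integral_sub_le_of_forall_continuous {d : ℕ} {μ μ' : Measure (Param d)}
    [IsFiniteMeasure μ] [IsFiniteMeasure μ'] {V : Param d → ℝ} (hVc : Continuous V)
    (hV0 : ∀ y, 0 ≤ V y) (hV : Integrable V μ) (hV' : Integrable V μ') {A : ℝ}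
    (hA : ∀ h : BoundedContinuousFunction (Param d) ℝ, (∀ y, |h y| ≤ V y) →
      |∫ y, h y ∂μ - ∫ y, h y ∂μ'| ≤ A)
    {h : Param d → ℝ} (hm : Measurable h) (hh : ∀ y, |h y| ≤ V y) :
    |∫ y, h y ∂μ - ∫ y, h y ∂μ'| ≤ A := by
  have hi : Integrable h μ := hV.mono' hm.aestronglyMeasurable (ae_of_all _ hh)
  have hi' : Integrable h μ' := hV'.mono' hm.aestronglyMeasurable (ae_of_all _ hh)
  refine le_of_forall_pos_le_add fun ε hε => ?_
  -- Approximation in `L¹(μ + μ')` yields one `g` whose errors for both measures add up to at most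
  -- `ε`.
  obtain ⟨g, hg, hgε, hgc, hgi⟩ :=
    (hi.add_measure hi').exists_hasCompactSupport_integral_sub_le hε
  obtain ⟨hgμ, hgμ'⟩ := integrable_add_measure.1 hgi
  -- Clamping restores `|k| ≤ V` and brings `k` no further from `h`, which already lies between `-V`
  -- and `V`. Boundedness of `k` comes from `g`, as `V` may be unbounded.
  set k : Param d → ℝ := fun y => max (-V y) (min (g y) (V y)) with hk
  have hkc : Continuous k := by fun_prop
  have hkV : ∀ y, |k y| ≤ V y := fun y => by
    have := hV0 y
    exact abs_le.2 ⟨le_max_left _ _, max_le (by linarith) (min_le_right _ _)⟩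
  have hhk : ∀ y, |h y - k y| ≤ |h y - g y| := fun y => by
    obtain ⟨h1, h2⟩ := abs_le.1 (hh y)
    have e : h y = max (-V y) (min (h y) (V y)) := by
      rw [min_eq_left h2, max_eq_right h1]
    calc |h y - k y| = |max (-V y) (min (h y) (V y)) - max (-V y) (min (g y) (V y))| := by
          rw [← e]
      _ ≤ |min (h y) (V y) - min (g y) (V y)| := by
          simpa using abs_max_sub_max_le_max (-V y) (min (h y) (V y)) (-V y) (min (g y) (V y))
      _ ≤ |h y - g y| := by
          simpa using abs_min_sub_min_le_max (h y) (V y) (g y) (V y)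
  have hkg : ∀ y, |k y| ≤ |g y| := fun y => by
    have := hV0 y
    simp only [hk]
    rcases le_total (g y) (V y) with h1 | h1
    · rw [min_eq_left h1]
      rcases le_total (-V y) (g y) with h2 | h2
      · rw [max_eq_right h2]
      · rw [max_eq_left h2, abs_neg, abs_of_nonneg this, abs_of_nonpos (by linarith)]
        linarith
    · rw [min_eq_right h1, max_eq_right (by linarith), abs_of_nonneg this]
      exact h1.trans (le_abs_self _)
  obtain ⟨b, hb⟩ := hg.exists_bound_of_continuous hgc
  let K : BoundedContinuousFunction (Param d) ℝ :=
    BoundedContinuousFunction.ofNormedAddCommGroup k hkc b fun y => (hkg y).trans (hb y)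
  have hKA := hA K hkV
  have hKi : Integrable k μ := hV.mono' hkc.aestronglyMeasurable (ae_of_all _ hkV)
  have hKi' : Integrable k μ' := hV'.mono' hkc.aestronglyMeasurable (ae_of_all _ hkV)
  have key : ∀ {ρ : Measure (Param d)}, Integrable h ρ → Integrable k ρ → Integrable g ρ →
      |∫ y, h y ∂ρ - ∫ y, k y ∂ρ| ≤ ∫ y, ‖h y - g y‖ ∂ρ := fun {ρ} h1 h2 h3 => by
    rw [← integral_sub h1 h2, ← Real.norm_eq_abs]
    exact (norm_integral_le_integral_norm _).trans
      (integral_mono (h1.sub h2).norm (h1.sub h3).norm hhk)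
  have k1 := key hi hKi hgμ
  have k2 := key hi' hKi' hgμ'
  have hsum : ∫ y, ‖h y - g y‖ ∂(μ + μ') = ∫ y, ‖h y - g y‖ ∂μ + ∫ y, ‖h y - g y‖ ∂μ' :=
    integral_add_measure (hi.sub hgμ).norm (hi'.sub hgμ').norm
  rw [hsum] at hgε
  have hKA' : |∫ y, k y ∂μ - ∫ y, k y ∂μ'| ≤ A := hKA
  rw [abs_le] at k1 k2 hKA' ⊢
  constructor <;> linarith [k1.1, k1.2, k2.1, k2.2, hKA'.1, hKA'.2]

theorem exists_stable_shift_bound_measurable {d : ℕ} {α p σ : ℝ} (hα : α ∈ Ioo (0 : ℝ) 2)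
    (hp0 : 0 < p) (hp1 : p ≤ 1) (hpα : p < α) (hσ : 0 < σ)
    {ν : Measure (Param d)} [IsProbabilityMeasure ν] (hν : IsRotInvStable α ν) :
    ∃ M : ℝ, 0 ≤ M ∧ ∀ (h : Param d → ℝ) (c a a' : Param d), Measurable h →
      (∀ y, |h y| ≤ lyap p c y) →
      |∫ z, h (a + σ • z) ∂ν - ∫ z, h (a' + σ • z) ∂ν|
        ≤ M * (‖a - a'‖ * (1 + ‖a - c‖ ^ p + ‖a' - c‖ ^ p)) := by
  obtain ⟨M, hM, hMb⟩ := exists_stable_shift_bound hα hp0 hp1 hσ hν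
  refine ⟨M, hM, fun h c a a' hm hh => ?_⟩
  have hmeas : ∀ w : Param d, Measurable fun z : Param d => w + σ • z := fun w => by fun_prop
  have hV : ∀ w : Param d, Integrable (lyap p c) (ν.map fun z => w + σ • z) := fun w =>
    (integrable_map_measure (continuous_lyap p c).aestronglyMeasurable
      (hmeas w).aemeasurable).2 (integrable_lyap_add_smul hp0 hp1 hpα hν c w σ)
  have hmap : ∀ (w : Param d) {g : Param d → ℝ}, Measurable g →
      ∫ y, g y ∂(ν.map fun z => w + σ • z) = ∫ z, g (w + σ • z) ∂ν := fun w g hg =>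
    integral_map (hmeas w).aemeasurable hg.aestronglyMeasurable
  have key := abs_integral_sub_le_of_forall_continuous (continuous_lyap p c) (lyap_nonneg p c)
    (hV a) (hV a') (A := M * (‖a - a'‖ * (1 + ‖a - c‖ ^ p + ‖a' - c‖ ^ p)))
    (fun g hg => by
      rw [hmap a g.continuous.measurable, hmap a' g.continuous.measurable]
      exact hMb g c a a' hg) hm hh
  rwa [hmap a hm, hmap a' hm] at key

/-! ### Gradient and stationary points of the empirical risk -/

section Risk

variable {d n : ℕ} {E : Type*} [NormedAddCommGroup E] {𝒳 : Set E} {f : Param d → E → ℝ}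
  {K₁ K₂ B m K D : ℝ} {X X' : Fin n → E}

theorem gradient_empRisk (hf : PseudoLipschitzGrad 𝒳 f K₁ K₂) (hX : ∀ i, X i ∈ 𝒳)
    (θ : Param d) :
    gradient (empRisk f X) θ = (n : ℝ)⁻¹ • ∑ i, gradient (fun ϑ => f ϑ (X i)) θ := by
  refine HasGradientAt.gradient ?_
  rw [hasGradientAt_iff_hasFDerivAt, map_smul, map_sum]
  have h : ∀ i ∈ Finset.univ, HasFDerivAt (fun ϑ => f ϑ (X i))
      (InnerProductSpace.toDual ℝ (Param d) (gradient (fun ϑ => f ϑ (X i)) θ)) θ := fun i _ =>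
    hasGradientAt_iff_hasFDerivAt.1 (hf.differentiable _ (hX i) θ).hasGradientAt
  exact (HasFDerivAt.fun_sum h).const_mul (n : ℝ)⁻¹

theorem norm_gradient_empRisk_sub_le (hn : 0 < n) (hf : PseudoLipschitzGrad 𝒳 f K₁ K₂)
    (hX : ∀ i, X i ∈ 𝒳) (θ θ' : Param d) :
    ‖gradient (empRisk f X) θ - gradient (empRisk f X) θ'‖ ≤ K₁ * ‖θ - θ'‖ := by
  have hn' : (0 : ℝ) < n := by exact_mod_cast hn
  rw [gradient_empRisk hf hX, gradient_empRisk hf hX, ← smul_sub, ← Finset.sum_sub_distrib,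
    norm_smul, Real.norm_of_nonneg (by positivity), inv_mul_le_iff₀ hn']
  refine (norm_sum_le _ _).trans ?_
  calc _ ≤ ∑ _i : Fin n, K₁ * ‖θ - θ'‖ := Finset.sum_le_sum fun i _ => by
        simpa using hf.bound _ (hX i) _ (hX i) θ θ'
    _ = _ := by simp

/-- All summands but one cancel; this is the source of the rate `1 / n`. -/
theorem norm_gradient_empRisk_sub_le_of_neighboring (hf : PseudoLipschitzGrad 𝒳 f K₁ K₂)
    (hK₂ : 0 ≤ K₂) (hD : ∀ x ∈ 𝒳, ∀ x' ∈ 𝒳, ‖x - x'‖ ≤ D)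
    (hX : ∀ i, X i ∈ 𝒳) (hX' : ∀ i, X' i ∈ 𝒳) (hN : Neighboring X X') (θ : Param d) :
    ‖gradient (empRisk f X) θ - gradient (empRisk f X') θ‖
      ≤ (n : ℝ)⁻¹ * (K₂ * |D| * (2 * ‖θ‖ + 1)) := by
  obtain ⟨i, hi⟩ := hN
  rw [gradient_empRisk hf hX, gradient_empRisk hf hX', ← smul_sub, ← Finset.sum_sub_distrib,
    Finset.sum_eq_single i (fun j _ hj => by rw [hi j hj, sub_self]) (by simp),
    norm_smul, Real.norm_of_nonneg (by positivity)]
  gcongr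
  refine (hf.bound _ (hX i) _ (hX' i) θ θ).trans ?_
  rw [sub_self, norm_zero, mul_zero, zero_add]
  have h1 : ‖X i - X' i‖ ≤ |D| := (hD _ (hX i) _ (hX' i)).trans (le_abs_self D)
  calc _ ≤ K₂ * |D| * (‖θ‖ + ‖θ‖ + 1) := by gcongr
    _ = _ := by ring

/-- Averaged dissipativity between `θ` and `0` gives `m‖θ‖² - K ≤ B‖θ‖`. The radius depends on
neither `n` nor the data, so the stationary points of the two objectives can be compared without a
common one. -/
theorem norm_le_of_gradient_empRisk_eq_zero (hn : 0 < n) (hf : PseudoLipschitzGrad 𝒳 f K₁ K₂)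
    (hd : Dissipative 𝒳 f B m K) (hB : 0 ≤ B) (hm : 0 < m) (hK : 0 ≤ K)
    (hX : ∀ i, X i ∈ 𝒳) {θ : Param d} (hθ : gradient (empRisk f X) θ = 0) :
    ‖θ‖ ≤ 1 + (B + K) / m := by
  have hn' : (0 : ℝ) < n := by exact_mod_cast hn
  set S : Param d → Param d := fun θ => ∑ i, gradient (fun ϑ => f ϑ (X i)) θ with hS
  have hS0 : S θ = 0 := by
    rw [gradient_empRisk hf hX, smul_eq_zero] at hθ
    exact hθ.resolve_left (by positivity)
  have h1 : n * (m * ‖θ‖ ^ 2 - K) ≤ inner ℝ (S θ - S 0) θ := by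
    simp only [hS]
    rw [← Finset.sum_sub_distrib, sum_inner]
    calc n * (m * ‖θ‖ ^ 2 - K) = ∑ _i : Fin n, (m * ‖θ‖ ^ 2 - K) := by simp [mul_sub]
      _ ≤ _ := Finset.sum_le_sum fun i _ => by simpa using hd.dissip _ (hX i) θ 0
  have h2 : inner ℝ (S θ - S 0) θ ≤ n * B * ‖θ‖ := by
    rw [hS0, zero_sub]
    refine (real_inner_le_norm _ _).trans ?_
    rw [norm_neg]
    gcongr
    refine (norm_sum_le _ _).trans ?_
    calc _ ≤ ∑ _i : Fin n, B := Finset.sum_le_sum fun i _ => hd.grad_zero _ (hX i)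
      _ = _ := by simp
  have h3 : m * ‖θ‖ ^ 2 - K ≤ B * ‖θ‖ := by
    have := h1.trans h2
    rw [mul_assoc] at this
    exact le_of_mul_le_mul_left this hn'
  rcases le_total ‖θ‖ 1 with h | h
  · have : 0 ≤ (B + K) / m := by positivity
    linarith
  · have h4 : ‖θ‖ ≤ (B + K) / m := by
      rw [le_div_iff₀ hm]
      have h5 : ‖θ‖ * (‖θ‖ * m) ≤ ‖θ‖ * (B + K) := by nlinarith
      exact le_of_mul_le_mul_left h5 (by linarith)
    linarith

end Risk

/-! ### Combining the smoothing and drift estimates -/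

theorem lyap_eq_rpow_sqrt {d : ℕ} (q : ℝ) (c θ : Param d) :
    lyap q c θ = √(1 + ‖θ - c‖ ^ 2) ^ q := by
  rw [lyap, Real.sqrt_eq_rpow, ← Real.rpow_mul (by positivity)]
  congr 1
  ring

theorem shift_weight_le {M A₁ A₂ W p x y z n : ℝ} (hM : 0 ≤ M) (hA₁ : 0 ≤ A₁) (hA₂ : 0 ≤ A₂)
    (hW : 1 ≤ W) (hp : 0 ≤ p) (hy0 : 0 ≤ y) (hz0 : 0 ≤ z) (hn : 0 < n)
    (hx : x ≤ n⁻¹ * (A₁ * W)) (hy : y ≤ A₂ * W) (hz : z ≤ (A₁ + A₂) * W) :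
    M * (x * (1 + y ^ p + z ^ p))
      ≤ M * A₁ * (1 + A₂ ^ p + (A₁ + A₂) ^ p) / n * W ^ (1 + p) := by
  have hW0 : 0 < W := by linarith
  have h1 : 1 ≤ W ^ p := Real.one_le_rpow hW hp
  have h2 : y ^ p ≤ A₂ ^ p * W ^ p := by
    rw [← Real.mul_rpow hA₂ hW0.le]
    exact Real.rpow_le_rpow hy0 hy hp
  have h3 : z ^ p ≤ (A₁ + A₂) ^ p * W ^ p := by
    rw [← Real.mul_rpow (by positivity) hW0.le]
    exact Real.rpow_le_rpow hz0 hz hp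
  have hyp : 0 ≤ y ^ p := by positivity
  have hzp : 0 ≤ z ^ p := by positivity
  calc M * (x * (1 + y ^ p + z ^ p))
      ≤ M * (n⁻¹ * (A₁ * W) * (W ^ p + A₂ ^ p * W ^ p + (A₁ + A₂) ^ p * W ^ p)) := by gcongr
    _ = _ := by
      rw [Real.rpow_add hW0, Real.rpow_one]
      ring

end NoisyGD

theorem mainTheorem3 {d : ℕ} {α p η σ K₁ K₂ B m K D : ℝ}
    (hα : α ∈ Set.Ioo (1 : ℝ) 2) (hp : p ∈ Set.Ioo 0 (min (1 / 2) (α - 1)))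
    (hη : 0 < η) (hσ : 0 < σ) (hK₁ : 0 < K₁) (hK₂ : 0 < K₂)
    (hB : 0 < B) (hm : 0 < m) (hK : 0 < K)
    (ν : Measure (NoisyGD.Param d)) [IsProbabilityMeasure ν]
    (hν : NoisyGD.IsRotInvStable α ν) :
    ∃ C : ℝ, 0 < C ∧
      ∀ (E : Type*) [NormedAddCommGroup E] (𝒳 : Set E)
        (_ : ∀ x ∈ 𝒳, ∀ x' ∈ 𝒳, ‖x - x'‖ ≤ D)
        (f : NoisyGD.Param d → E → ℝ)
        (_ : NoisyGD.PseudoLipschitzGrad 𝒳 f K₁ K₂)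
        (_ : NoisyGD.Dissipative 𝒳 f B m K)
        (n : ℕ) (_ : 0 < n) (X X' : Fin n → E)
        (_ : ∀ i, X i ∈ 𝒳) (_ : ∀ i, X' i ∈ 𝒳) (_ : NoisyGD.Neighboring X X')
        (θs θs' : NoisyGD.Param d)
        (_ : gradient (NoisyGD.empRisk f X) θs = 0)
        (_ : gradient (NoisyGD.empRisk f X') θs' = 0),
        (∀ θ,
          Integrable (NoisyGD.lyap p θs) (NoisyGD.gdKernel η σ (NoisyGD.empRisk f X) ν θ) ∧
          Integrable (NoisyGD.lyap p θs) (NoisyGD.gdKernel η σ (NoisyGD.empRisk f X') ν θ)) ∧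
        NoisyGD.kernelDist (NoisyGD.lyap p θs) (NoisyGD.lyap (1 + p) θs')
            (NoisyGD.gdKernel η σ (NoisyGD.empRisk f X) ν)
            (NoisyGD.gdKernel η σ (NoisyGD.empRisk f X') ν)
          ≤ ENNReal.ofReal (C / n) := by
  have hp0 : 0 < p := hp.1
  have hp1 : p ≤ 1 := by linarith [hp.2.trans_le (min_le_left _ _)]
  have hpα : p < α := by linarith [hp.2.trans_le (min_le_right _ _)]
  obtain ⟨M, hM, hMb⟩ := NoisyGD.exists_stable_shift_bound_measurable
    ⟨by linarith [hα.1], hα.2⟩ hp0 hp1 hpα hσ hν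
  set R := 1 + (B + K) / m with hR
  have hR0 : 0 ≤ R := by positivity
  -- With `‖θ‖ ≤ W + R` and `W ≥ 1`, one has `2‖θ‖ + 1 ≤ (3 + 2R)W`, and `‖θ - θs‖ ≤ W + 2R ≤ (1 +
  -- 2R)W` for `A₂`.
  set A₁ := η * (K₂ * |D| * (3 + 2 * R)) with hA₁
  set A₂ := (1 + η * K₁) * (1 + 2 * R) with hA₂
  have hA₁0 : 0 ≤ A₁ := by positivity
  have hA₂0 : 0 ≤ A₂ := by positivity
  -- The added `1` keeps the constant positive when `M` or `D` vanishes.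
  refine ⟨M * A₁ * (1 + A₂ ^ p + (A₁ + A₂) ^ p) + 1, by positivity, ?_⟩
  intro E _ 𝒳 hD f hf hd n hn X X' hX hX' hN θs θs' hθs hθs'
  have hn' : (0 : ℝ) < n := by exact_mod_cast hn
  have hn1 : (n : ℝ)⁻¹ ≤ 1 := inv_le_one_of_one_le₀ (by exact_mod_cast hn)
  have hmeas : ∀ (F : NoisyGD.Param d → ℝ) (θ : NoisyGD.Param d),
      Measurable (NoisyGD.gdStep η σ F θ) := fun F θ =>
    (NoisyGD.measurable_gdStep η σ F).comp measurable_prodMk_left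
  have hint : ∀ (F : NoisyGD.Param d → ℝ) (θ : NoisyGD.Param d),
      Integrable (NoisyGD.lyap p θs) (NoisyGD.gdKernel η σ F ν θ) := fun F θ =>
    (integrable_map_measure (NoisyGD.continuous_lyap p θs).aestronglyMeasurable
      (hmeas F θ).aemeasurable).2
      (NoisyGD.integrable_lyap_add_smul hp0 hp1 hpα hν θs (θ - η • gradient F θ) σ)
  refine ⟨fun θ => ⟨hint _ θ, hint _ θ⟩, ?_⟩
  have hs := NoisyGD.norm_le_of_gradient_empRisk_eq_zero hn hf hd hB.le hm hK.le hX hθs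
  have hs' := NoisyGD.norm_le_of_gradient_empRisk_eq_zero hn hf hd hB.le hm hK.le hX' hθs'
  rw [← hR] at hs hs'
  refine iSup_le fun θ => ENNReal.div_le_of_le_mul (iSup₂_le fun g hg => ?_)
  rw [← ENNReal.ofReal_mul (by positivity)]
  apply ENNReal.ofReal_le_ofReal
  have hkern : ∀ F : NoisyGD.Param d → ℝ, ∫ y, g y ∂NoisyGD.gdKernel η σ F ν θ
      = ∫ z, g (θ - η • gradient F θ + σ • z) ∂ν := fun F =>
    integral_map (hmeas F θ).aemeasurable hg.1.aestronglyMeasurable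
  rw [hkern, hkern, NoisyGD.lyap_eq_rpow_sqrt]
  set a := θ - η • gradient (NoisyGD.empRisk f X) θ with ha
  set a' := θ - η • gradient (NoisyGD.empRisk f X') θ with ha'
  set W := √(1 + ‖θ - θs'‖ ^ 2) with hW
  have hW1 : 1 ≤ W := by
    rw [hW, Real.one_le_sqrt]
    linarith [sq_nonneg ‖θ - θs'‖]
  have hTW : ‖θ - θs'‖ ≤ W := Real.le_sqrt_of_sq_le (by linarith)
  have hθW : ‖θ‖ ≤ W + R := by
    have := norm_add_le (θ - θs') θs'
    rw [sub_add_cancel] at this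
    linarith
  have hRW : R ≤ R * W := le_mul_of_one_le_right hR0 hW1
  have hx : ‖a - a'‖ ≤ (n : ℝ)⁻¹ * (A₁ * W) := by
    have e : a - a' = -(η • (gradient (NoisyGD.empRisk f X) θ
        - gradient (NoisyGD.empRisk f X') θ)) := by rw [ha, ha', smul_sub]; abel
    rw [e, norm_neg, norm_smul, Real.norm_of_nonneg hη.le]
    have h1 := NoisyGD.norm_gradient_empRisk_sub_le_of_neighboring hf hK₂.le hD hX hX' hN θ
    have h2 : 2 * ‖θ‖ + 1 ≤ (3 + 2 * R) * W := by linarith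
    calc _ ≤ η * ((n : ℝ)⁻¹ * (K₂ * |D| * ((3 + 2 * R) * W))) := by
          refine mul_le_mul_of_nonneg_left (h1.trans ?_) hη.le
          gcongr
      _ = _ := by rw [hA₁]; ring
  have hy : ‖a - θs‖ ≤ A₂ * W := by
    -- The vanishing gradient at `θs` is inserted so that the Lipschitz bound applies.
    have e : a - θs = (θ - θs) - η • (gradient (NoisyGD.empRisk f X) θ
        - gradient (NoisyGD.empRisk f X) θs) := by rw [ha, hθs, sub_zero]; abel
    have h1 := NoisyGD.norm_gradient_empRisk_sub_le hn hf hX θ θs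
    have h2 : ‖θ - θs‖ ≤ (1 + 2 * R) * W := by linarith [norm_sub_le θ θs]
    rw [e]
    refine (norm_sub_le _ _).trans ?_
    rw [norm_smul, Real.norm_of_nonneg hη.le]
    calc _ ≤ ‖θ - θs‖ + η * (K₁ * ‖θ - θs‖) := by gcongr
      _ = (1 + η * K₁) * ‖θ - θs‖ := by ring
      _ ≤ (1 + η * K₁) * ((1 + 2 * R) * W) := by gcongr
      _ = _ := by rw [hA₂]; ring
  have hz : ‖a' - θs‖ ≤ (A₁ + A₂) * W := by
    -- `θs` need not be stationary for the second objective, so `a'` is compared with it through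
    -- `a`.
    have h1 : ‖a' - θs‖ ≤ ‖a - a'‖ + ‖a - θs‖ := by
      rw [norm_sub_rev a a']
      simpa using norm_add_le (a' - a) (a - θs)
    have h2 : (n : ℝ)⁻¹ * (A₁ * W) ≤ A₁ * W := mul_le_of_le_one_left (by positivity) hn1
    linarith
  refine (hMb g θs a a' hg.1 hg.2).trans ((NoisyGD.shift_weight_le hM hA₁0 hA₂0 hW1 hp0.le
    (norm_nonneg _) (norm_nonneg _) hn' hx hy hz).trans ?_)
  gcongr
  linarith
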